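/- **Online graph partitioning.** Let $k,\ell$ be natural numbers. There are $\ell$ servers and $\ell k$ vertices, each of volume $1/k$; initially every server holds exactly $k$ vertices. The edges of a graph on these vertices are revealed one by one. After each edge, an online algorithm, which knows $k$, $\ell$, the initial assignment and the edges revealed so far, has to assign the vertices to the servers such that all vertices of each connected component of the revealed graph are on the same server (cc-condition). Moving a vertex to another server costs $1/k$. It is guaranteed that the connected components of the final graph can be assigned to the servers such that every server receives volume at most $1$; $\operatorname{cost}(\mathrm{OPT})$ is the minimum cost of moving the vertices from their initial servers to such an assignment. With $(1+\varepsilon)$-resource augmentation, the online algorithm may place volume up to $1+\varepsilon$ on each server. **Theorem.** There is an absolute constant $c>0$ such that for every $\varepsilon>0$ there are a constant $C=C(\varepsilon)$ and a deterministic online algorithm $\mathrm{ONL}$ with the following properties. Each assignment of $\mathrm{ONL}$ is computed in time polynomial in $k$, $\ell$ and the number of edges revealed so far (the polynomial depends on $\varepsilon$ only). For all $\ell$, all $k\ge c\cdot\max\{1,\varepsilon^{-4}\}$, all initial assignments and all edge sequences as above, after each edge the assignment of $\mathrm{ONL}$ satisfies the cc-condition and places volume at most $1+\varepsilon$ on each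 server, and the total cost satisfies $$\operatorname{cost}(\mathrm{ONL})\le C\cdot \ell\log k\cdot \operatorname{cost}(\mathrm{OPT}).$$ That is, $\mathrm{ONL}$ has strict competitive ratio $O(\ell\log k)$ for every fixed $\varepsilon$. -/

import Mathlib

/-! ## Computation model: WHILE programs over binary trees

Data are binary trees (lists are right-nested pairs), as in the classical WHILE language.
Every elementary operation is charged for the whole tree that it reads or copies. So a run of
total time `t` only handles trees of size at most `t`, a Turing machine simulates it in time
polynomial in `t`, and the program simulates one step of a Turing machine (tapes stored as pairs
of lists) in time linear in the used part of the tapes. Polynomial time in this model is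
therefore polynomial time on Turing machines. -/

namespace WhileLang

/-- Binary trees, the data values of the language. -/
inductive Data : Type
  | nil : Data
  | cons : Data → Data → Data

/-- Number of nodes of a tree (leaves included). -/
def Data.size : Data → ℕ
  | .nil => 1
  | .cons a b => a.size + b.size + 1

/-- Natural numbers in unary. -/
def Data.ofNat : ℕ → Data
  | 0 => .nil
  | n + 1 => .cons .nil (Data.ofNat n)

/-- Lists as right-nested pairs. -/
def Data.ofList : List Data → Data
  | [] => .nil
  | a :: l => .cons a (Data.ofList l)

/-- Programs; a program transforms a tree into a tree. -/
inductive Prog : Type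
  /-- return the input -/
  | skip : Prog
  /-- return the empty tree -/
  | empty : Prog
  /-- return the left subtree (`nil` on `nil`) -/
  | head : Prog
  /-- return the right subtree (`nil` on `nil`) -/
  | tail : Prog
  /-- run both programs on the input and pair the two results -/
  | pair : Prog → Prog → Prog
  /-- run the first program, then the second one on its result -/
  | seq : Prog → Prog → Prog
  /-- `ite c p q`: run `p` if the test `c` returns a non-`nil` tree, and `q` otherwise -/
  | ite : Prog → Prog → Prog → Prog
  /-- `loop c p`: as long as the test `c` returns a non-`nil` tree, replace the value by the
  result of `p` on it -/
  | loop : Prog → Prog → Prog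

/-- `Run p x y t`: on input `x` the program `p` halts with output `y` after time exactly `t`. -/
inductive Run : Prog → Data → Data → ℕ → Prop
  | skip (x : Data) : Run .skip x x x.size
  | empty (x : Data) : Run .empty x .nil 1
  | head_nil : Run .head .nil .nil 1
  | head_cons (a b : Data) : Run .head (.cons a b) a (Data.cons a b).size
  | tail_nil : Run .tail .nil .nil 1
  | tail_cons (a b : Data) : Run .tail (.cons a b) b (Data.cons a b).size
  | pair {p q : Prog} {x y z : Data} {s t : ℕ} :
      Run p x y s → Run q x z t → Run (.pair p q) x (.cons y z) (s + t + 1)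
  | seq {p q : Prog} {x y z : Data} {s t : ℕ} :
      Run p x y s → Run q y z t → Run (.seq p q) x z (s + t + 1)
  | ite_true {c p q : Prog} {x a b y : Data} {s t : ℕ} :
      Run c x (.cons a b) s → Run p x y t → Run (.ite c p q) x y (s + t + 1)
  | ite_false {c p q : Prog} {x y : Data} {s t : ℕ} :
      Run c x .nil s → Run q x y t → Run (.ite c p q) x y (s + t + 1)
  | loop_done {c p : Prog} {x : Data} {s : ℕ} :
      Run c x .nil s → Run (.loop c p) x x (s + x.size + 1)
  | loop_step {c p : Prog} {x a b y z : Data} {s t r : ℕ} :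
      Run c x (.cons a b) s → Run p x y t → Run (.loop c p) y z r →
        Run (.loop c p) x z (s + t + r + 1)

end WhileLang

/-! ## Online graph partitioning

There are `ℓ` servers and `ℓ * k` vertices; a vertex has volume `1 / k`. An assignment of vertices
to servers is a function `Fin (ℓ * k) → Fin ℓ`, and a request is an edge `(u, v)`. -/

namespace GraphPartitioning

/-- The graph on `n` vertices whose edges are the revealed ones. -/
def revealedGraph {n : ℕ} (es : List (Fin n × Fin n)) : SimpleGraph (Fin n) :=
  SimpleGraph.fromRel fun u v => (u, v) ∈ es

/-- The cc-condition: vertices of the same connected component are on the same server. -/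
def CCCondition {n ℓ : ℕ} (es : List (Fin n × Fin n)) (σ : Fin n → Fin ℓ) : Prop :=
  ∀ u v : Fin n, (revealedGraph es).Reachable u v → σ u = σ v

/-- The number of vertices that `σ` places on the server `s`. -/
def load {n ℓ : ℕ} (σ : Fin n → Fin ℓ) (s : Fin ℓ) : ℕ :=
  (Finset.univ.filter fun v => σ v = s).card

/-- The total volume placed on each server is at most `a`. -/
def WithinCapacity {n ℓ : ℕ} (k : ℕ) (a : ℝ) (σ : Fin n → Fin ℓ) : Prop :=
  ∀ s : Fin ℓ, (load σ s : ℝ) * (1 / k) ≤ a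

/-- The cost of changing the assignment `σ` to `τ`: `1 / k` for every vertex that is moved. -/
noncomputable def moveCost {n ℓ : ℕ} (k : ℕ) (σ τ : Fin n → Fin ℓ) : ℝ :=
  ((Finset.univ.filter fun v => σ v ≠ τ v).card : ℝ) * (1 / k)

/-- The assignments of the final components that are available to the offline algorithm: they
place no more than volume `1` on any server. -/
def OfflineFeasible {n ℓ : ℕ} (k : ℕ) (es : List (Fin n × Fin n)) (σ : Fin n → Fin ℓ) : Prop :=
  CCCondition es σ ∧ WithinCapacity k 1 σ

/-- The cost of the optimal offline algorithm: the minimum cost of moving the vertices from their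
source servers to an offline feasible assignment. -/
noncomputable def optCost {n ℓ : ℕ} (k : ℕ) (src : Fin n → Fin ℓ) (es : List (Fin n × Fin n)) :
    ℝ :=
  ⨅ σ : {σ : Fin n → Fin ℓ // OfflineFeasible k es σ}, moveCost k src σ.1

/-- The inputs of the problem: initially every server holds exactly `k` vertices, and the
components of the graph of all requests can be assigned to the servers within their capacity. -/
def IsInstance {k ℓ : ℕ} (src : Fin (ℓ * k) → Fin ℓ) (es : List (Fin (ℓ * k) × Fin (ℓ * k))) :
    Prop :=
  (∀ s : Fin ℓ, load src s = k) ∧ ∃ σ : Fin (ℓ * k) → Fin ℓ, OfflineFeasible k es σ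

/-- A deterministic online algorithm: `place k ℓ src es` is the assignment after the requests `es`
(in chronological order) if `src` is the initial assignment. It knows `k`, `ℓ`, `src` and the
requests so far, and nothing about later requests. -/
structure OnlineAlgorithm : Type where
  place : (k ℓ : ℕ) → (Fin (ℓ * k) → Fin ℓ) → List (Fin (ℓ * k) × Fin (ℓ * k)) →
    Fin (ℓ * k) → Fin ℓ
  place_nil : ∀ (k ℓ : ℕ) (src : Fin (ℓ * k) → Fin ℓ), place k ℓ src [] = src

namespace OnlineAlgorithm

/-- The total volume of the vertices that the algorithm moves while it serves `es`. -/
noncomputable def cost (A : OnlineAlgorithm) {k ℓ : ℕ} (src : Fin (ℓ * k) → Fin ℓ)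
    (es : List (Fin (ℓ * k) × Fin (ℓ * k))) : ℝ :=
  ∑ i ∈ Finset.range es.length,
    moveCost k (A.place k ℓ src (es.take i)) (A.place k ℓ src (es.take (i + 1)))

/-- After each request, the current assignment satisfies the cc-condition for the edges revealed
so far, and places no more than volume `1 + ε` on any server. -/
def Serves (A : OnlineAlgorithm) (ε : ℝ) {k ℓ : ℕ} (src : Fin (ℓ * k) → Fin ℓ)
    (es : List (Fin (ℓ * k) × Fin (ℓ * k))) : Prop :=
  ∀ i : ℕ, i ≤ es.length →
    CCCondition (es.take i) (A.place k ℓ src (es.take i)) ∧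
      WithinCapacity k (1 + ε) (A.place k ℓ src (es.take i))

open WhileLang in
/-- An assignment as a tree: the list of the servers of the vertices. -/
def encodeAssignment {n ℓ : ℕ} (σ : Fin n → Fin ℓ) : Data :=
  Data.ofList (List.ofFn fun v => Data.ofNat (σ v).val)

open WhileLang in
/-- What the algorithm knows, as a tree. -/
def encodeInput (k ℓ : ℕ) (src : Fin (ℓ * k) → Fin ℓ)
    (es : List (Fin (ℓ * k) × Fin (ℓ * k))) : Data :=
  .cons (Data.ofNat k) (.cons (Data.ofNat ℓ) (.cons (encodeAssignment src)
    (Data.ofList (es.map fun e => .cons (Data.ofNat e.1.val) (Data.ofNat e.2.val)))))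

open WhileLang in
/-- One program computes, from `k`, `ℓ`, the initial assignment and the requests so far, the
current assignment in time polynomial in `k`, `ℓ` and the number of these requests. -/
def PolyTime (A : OnlineAlgorithm) : Prop :=
  ∃ (p : Prog) (T : Polynomial ℕ), ∀ (k ℓ : ℕ) (src : Fin (ℓ * k) → Fin ℓ)
    (es : List (Fin (ℓ * k) × Fin (ℓ * k))),
    ∃ t : ℕ, t ≤ T.eval (k + ℓ + es.length) ∧
      Run p (encodeInput k ℓ src es) (encodeAssignment (A.place k ℓ src es)) t

end OnlineAlgorithm

end GraphPartitioning

/-!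
# A deterministic online algorithm for graph partitioning

The algorithm maintains the components of the revealed graph as classes of vertices. When an edge
joins two classes, the smaller class is attracted by the server of the larger one. It works in two
phases. Let `OPT` be the number of vertices that an optimal assignment moves.

*First phase.* Call a vertex foreign if it is not on its source server. After an attraction, the
joint class moves to a server on which fewer than half as many of its vertices are foreign, if there
is one. So every class has at most twice as many foreign vertices as necessary, and by
`sum_minForeign_le` the total number of foreign vertices is at most `2 * OPT`. An attraction from
another server costs at most a constant times the growth of the potential
`∑ minForeign * (1 + log classSize)` (`attract_cost_le`), and a return home is paid for by the
decrease of the number of foreign vertices (`home_cost_le`). The total cost is therefore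
`O(OPT * log k)`. If some server is overloaded, then there are many foreign vertices, so that `OPT`
is at least a constant fraction of `k` (`four_mul_le_of_not_fits`). The second phase starts, and may
now cost `O(log k)` for each of the `ℓ * k` vertices.

*Second phase.* The attractions cost `O(ℓ * k * log k)` in total, since the class of a moved vertex
doubles its size. If an attraction overloads the server `t`, the algorithm tries all sequences of
a constant number `N` of elementary operations, each of which moves one class, and an initial
segment of the small classes of one server to another one. It takes the first result in which `t`
has slack again, and no server has become worse without having slack. This costs `O(k)`, which is
paid for by the volume that attractions have brought to `t` since it last had slack, or since the
phase began with a total excess of `O(ℓ * k)` (`Improves.excess_le`, `excess_le`).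

The point is that such a result exists (`exists_improvement`). Describe a server by the numbers of
its big classes of each rounded size, and by its rounded load. There are finitely many descriptions,
and the numbers of servers with each description, for the current assignment and for an offline
assignment, have the same total of big classes of each size. By Dickson's lemma, there are
boundedly many servers including `t` whose big classes can be redistributed among them as on equally
many servers of the offline assignment, and whose average load is about `k` (`exists_exchange`).
Afterwards, few sweeps of small classes balance the loads (`exists_sweeps`).

*Time.* `PT` is the class of functions between encoded types that programs compute in polynomial
time. It is closed under composition, pairing, case distinctions, and folds with intermediate
results of polynomial size (`PT.foldl`). The algorithm is written with list operations in this
class, and `record` translates between its lists and functions on the vertices.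
-/

/-! ### Polynomial time functions between encoded types -/

namespace PolyTimeData

open WhileLang

/-- Types whose elements are represented by trees. -/
class Enc (α : Type) where
  /-- The tree that represents an element. -/
  enc : α → Data

open Enc (enc)

instance : Enc ℕ := ⟨Data.ofNat⟩

instance : Enc Unit := ⟨fun _ => .nil⟩

instance : Enc Bool := ⟨fun b => bif b then .cons .nil .nil else .nil⟩

instance {α β : Type} [Enc α] [Enc β] : Enc (α × β) := ⟨fun p => .cons (enc p.1) (enc p.2)⟩

instance {α : Type} [Enc α] : Enc (List α) := ⟨fun l => Data.ofList (l.map enc)⟩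

/-- The size of the tree that represents `a`. -/
def esize {α : Type} [Enc α] (a : α) : ℕ := (enc a).size

variable {α β γ : Type} [Enc α] [Enc β] [Enc γ]

theorem enc_pair (a : α) (b : β) : enc (a, b) = .cons (enc a) (enc b) := rfl

theorem enc_cons (a : α) (l : List α) : enc (a :: l) = .cons (enc a) (enc l) := rfl

theorem enc_succ (n : ℕ) : enc (n + 1) = .cons .nil (enc n) := rfl

theorem esize_pair (a : α) (b : β) : esize (a, b) = esize a + esize b + 1 := rfl

theorem esize_nil : esize ([] : List α) = 1 := rfl

theorem esize_cons (a : α) (l : List α) : esize (a :: l) = esize a + esize l + 1 := rfl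

theorem esize_nat (n : ℕ) : esize n = 2 * n + 1 := by
  induction n with
  | zero => rfl
  | succ n ih =>
    have : esize (n + 1) = 1 + esize n + 1 := rfl
    omega

theorem esize_pos (a : α) : 1 ≤ esize a := by
  unfold esize
  cases enc a <;> simp [Data.size]

theorem esize_append (l l' : List α) : esize (l ++ l') + 1 = esize l + esize l' := by
  induction l with
  | nil => simp [esize_nil]; omega
  | cons a l ih => simp only [List.cons_append, esize_cons]; omega

theorem esize_reverse (l : List α) : esize l.reverse = esize l := by
  induction l with
  | nil => rfl
  | cons a l ih =>
    have := esize_append l.reverse [a]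
    simp only [List.reverse_cons, esize_cons, esize_nil] at *
    omega

theorem length_lt_esize (l : List α) : l.length < esize l := by
  induction l with
  | nil => simp [esize_nil]
  | cons a l ih => simp only [List.length_cons, esize_cons]; have := esize_pos a; omega

theorem esize_le_of_mem {l : List α} {a : α} (h : a ∈ l) : esize a < esize l := by
  induction l with
  | nil => simp at h
  | cons b l ih =>
    rw [esize_cons]
    rcases List.mem_cons.1 h with rfl | h
    · omega
    · have := ih h; omega

theorem esize_list_le {l : List α} {B : ℕ} (h : ∀ a ∈ l, esize a ≤ B) :
    esize l ≤ l.length * (B + 1) + 1 := by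
  induction l with
  | nil => simp [esize_nil]
  | cons b l ih =>
    rw [esize_cons, List.length_cons]
    have := ih fun a ha => h a (List.mem_cons_of_mem _ ha)
    have := h b List.mem_cons_self
    nlinarith

/-- The output of a run is no larger than its time. -/
theorem run_size_le {p : Prog} {x y : Data} {t : ℕ} (h : Run p x y t) : y.size ≤ t := by
  induction h <;> (try simp only [Data.size] at *) <;> omega

theorem eval_mono (P : Polynomial ℕ) {m n : ℕ} (h : m ≤ n) : P.eval m ≤ P.eval n := by
  induction P using Polynomial.induction_on' with
  | add p q hp hq => simpa using Nat.add_le_add hp hq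
  | monomial i a => simpa using Nat.mul_le_mul_left a (Nat.pow_le_pow_left h i)

/-- The function `f` is computed by a program in polynomial time. -/
def PT (f : α → β) : Prop :=
  ∃ (p : Prog) (P : Polynomial ℕ), ∀ a, ∃ t, t ≤ P.eval (esize a) ∧ Run p (enc a) (enc (f a)) t

theorem PT.esize_le {f : α → β} (hf : PT f) :
    ∃ P : Polynomial ℕ, ∀ a, esize (f a) ≤ P.eval (esize a) := by
  obtain ⟨p, P, h⟩ := hf
  refine ⟨P, fun a => ?_⟩
  obtain ⟨t, ht, hr⟩ := h a
  exact (run_size_le hr).trans ht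

/-- A function that leaves the representing tree unchanged. -/
theorem PT.of_enc_eq {f : α → β} (h : ∀ a, enc (f a) = enc a) : PT f :=
  ⟨.skip, .X, fun a => ⟨esize a, by simp, by rw [h]; exact .skip _⟩⟩

theorem PT.id : PT fun a : α => a := PT.of_enc_eq fun _ => rfl

theorem PT.comp {g : β → γ} {f : α → β} (hg : PT g) (hf : PT f) : PT fun a => g (f a) := by
  obtain ⟨p, P, hp⟩ := hf
  obtain ⟨q, Q, hq⟩ := hg
  refine ⟨.seq p q, P + Q.comp P + 1, fun a => ?_⟩
  obtain ⟨s, hs, rs⟩ := hp a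
  obtain ⟨t, ht, rt⟩ := hq (f a)
  refine ⟨_, ?_, .seq rs rt⟩
  have := eval_mono Q ((run_size_le rs).trans hs)
  simp only [Polynomial.eval_add, Polynomial.eval_comp, Polynomial.eval_one]
  unfold esize at *
  omega

theorem PT.pair {f : α → β} {g : α → γ} (hf : PT f) (hg : PT g) : PT fun a => (f a, g a) := by
  obtain ⟨p, P, hp⟩ := hf
  obtain ⟨q, Q, hq⟩ := hg
  refine ⟨.pair p q, P + Q + 1, fun a => ?_⟩
  obtain ⟨s, hs, rs⟩ := hp a
  obtain ⟨t, ht, rt⟩ := hq a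
  refine ⟨_, ?_, .pair rs rt⟩
  simp only [Polynomial.eval_add, Polynomial.eval_one]
  omega

theorem PT.fst {f : α → β × γ} (hf : PT f) : PT fun a => (f a).1 :=
  PT.comp (g := Prod.fst) ⟨.head, .X, fun a => ⟨esize a, by simp, .head_cons _ _⟩⟩ hf

theorem PT.snd {f : α → β × γ} (hf : PT f) : PT fun a => (f a).2 :=
  PT.comp (g := Prod.snd) ⟨.tail, .X, fun a => ⟨esize a, by simp, .tail_cons _ _⟩⟩ hf

theorem exists_run_const (d : Data) : ∃ (p : Prog) (t : ℕ), ∀ x, Run p x d t := by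
  induction d with
  | nil => exact ⟨.empty, 1, .empty⟩
  | cons a b iha ihb =>
    obtain ⟨p, s, hp⟩ := iha
    obtain ⟨q, t, hq⟩ := ihb
    exact ⟨.pair p q, _, fun x => .pair (hp x) (hq x)⟩

theorem PT.const (b : β) : PT fun _ : α => b := by
  obtain ⟨p, t, h⟩ := exists_run_const (enc b)
  exact ⟨p, .C t, fun a => ⟨t, by simp, h _⟩⟩

/-- Case distinction on a list. -/
theorem PT.listCases {l : γ → List α} {f : γ → β} {g : γ → α → List α → β} (hl : PT l)
    (hf : PT f) (hg : PT fun p : γ × α × List α => g p.1 p.2.1 p.2.2) :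
    PT fun c => match l c with
      | [] => f c
      | a :: t => g c a t := by
  have key : PT fun q : γ × List α => match q.2 with
      | [] => f q.1
      | a :: t => g q.1 a t := by
    obtain ⟨p, P, hp⟩ := hf.comp (PT.id.fst (β := γ) (γ := List α))
    obtain ⟨q, Q, hq⟩ := hg
    refine ⟨.ite .tail q p, .X + P + Q + 1, fun ⟨c, l⟩ => ?_⟩
    cases l with
    | nil =>
      obtain ⟨s, hs, rs⟩ := hp (c, [])
      refine ⟨_, ?_, .ite_false (.tail_cons _ _) rs⟩
      simp only [Polynomial.eval_add, Polynomial.eval_one, Polynomial.eval_X]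
      unfold esize at *
      rw [enc_pair] at *
      omega
    | cons a t =>
      obtain ⟨s, hs, rs⟩ := hq (c, a, t)
      refine ⟨_, ?_, .ite_true (.tail_cons _ _) rs⟩
      simp only [Polynomial.eval_add, Polynomial.eval_one, Polynomial.eval_X]
      unfold esize at *
      simp only [enc_pair, enc_cons] at *
      omega
  exact key.comp (PT.id.pair hl)

theorem PT.cond {b : γ → Bool} {f g : γ → β} (hb : PT b) (hf : PT f) (hg : PT g) :
    PT fun c => bif b c then f c else g c := by
  obtain ⟨r, R, hr⟩ := hb
  obtain ⟨p, P, hp⟩ := hf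
  obtain ⟨q, Q, hq⟩ := hg
  refine ⟨.ite r p q, R + P + Q + 1, fun c => ?_⟩
  obtain ⟨s, hs, rs⟩ := hr c
  obtain ⟨t, ht, rt⟩ := hp c
  obtain ⟨u, hu, ru⟩ := hq c
  simp only [Polynomial.eval_add, Polynomial.eval_one]
  cases h : b c with
  | false => exact ⟨s + u + 1, by omega, .ite_false (by rw [h] at rs; exact rs) ru⟩
  | true => exact ⟨s + t + 1, by omega, .ite_true (by rw [h] at rs; exact rs) rt⟩

theorem PT.ite {p : γ → Prop} [DecidablePred p] {f g : γ → β} (hb : PT fun c => decide (p c))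
    (hf : PT f) (hg : PT g) : PT fun c => if p c then f c else g c := by
  simpa [Bool.cond_decide] using PT.cond hb hf hg

theorem PT.cons {f : γ → α} {g : γ → List α} (hf : PT f) (hg : PT g) :
    PT fun c => f c :: g c :=
  PT.comp (g := fun p : α × List α => p.1 :: p.2) (PT.of_enc_eq fun _ => rfl) (hf.pair hg)

/-- The loop that folds `f` over a list, given bounds `W` for the sizes of the intermediate states
and for the times of the test and the body. -/
theorem run_loop_foldl {f : β → α → β} {c : γ} {tst body : Prog} {W : ℕ} (l : List α) (b : β)
    (hs : ∀ l₁ l₂, l = l₁ ++ l₂ → esize (c, l₁.foldl f b, l₂) ≤ W)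
    (ht : ∀ l₁ l₂, l = l₁ ++ l₂ →
      ∃ t, t ≤ W ∧ Run tst (enc (c, l₁.foldl f b, l₂)) (enc l₂) t)
    (hb : ∀ l₁ a l₂, l = l₁ ++ a :: l₂ → ∃ t, t ≤ W ∧
      Run body (enc (c, l₁.foldl f b, a :: l₂)) (enc (c, f (l₁.foldl f b) a, l₂)) t) :
    ∃ t, t ≤ (l.length + 1) * (2 * W + 1) ∧
      Run (.loop tst body) (enc (c, b, l)) (enc (c, l.foldl f b, ([] : List α))) t := by
  induction l generalizing b with
  | nil =>
    obtain ⟨t, h, r⟩ := ht [] [] rfl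
    refine ⟨_, ?_, .loop_done r⟩
    have := hs [] [] rfl
    simp only [List.foldl_nil, esize] at *
    simp
    omega
  | cons a l ih =>
    obtain ⟨t, h, r⟩ := ht [] (a :: l) rfl
    obtain ⟨t', h', r'⟩ := hb [] a l rfl
    obtain ⟨s, hs', rs⟩ := ih (f b a)
      (fun l₁ l₂ e => hs (a :: l₁) l₂ (by rw [e]; rfl))
      (fun l₁ l₂ e => ht (a :: l₁) l₂ (by rw [e]; rfl))
      (fun l₁ a' l₂ e => hb (a :: l₁) a' l₂ (by rw [e]; rfl))
    refine ⟨_, ?_, .loop_step r r' rs⟩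
    simp only [List.length_cons]
    nlinarith

/-- Polynomial time functions are closed under folds with intermediate results of polynomial
size. -/
theorem PT.foldl {f : γ → β → α → β} {b : γ → β} {l : γ → List α}
    (hf : PT fun p : γ × β × α => f p.1 p.2.1 p.2.2) (hb : PT b) (hl : PT l) (Q : Polynomial ℕ)
    (hQ : ∀ c l₁, l₁ <+: l c → esize (l₁.foldl (f c) (b c)) ≤ Q.eval (esize c)) :
    PT fun c => (l c).foldl (f c) (b c) := by
  have hbody : PT fun S : γ × β × α × List α => (S.1, f S.1 S.2.1 S.2.2.1, S.2.2.2) :=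
    PT.id.fst.pair ((hf.comp (PT.id.fst.pair (PT.id.snd.fst.pair PT.id.snd.snd.fst))).pair
      PT.id.snd.snd.snd)
  have htest : PT fun S : γ × β × List α => S.2.2 := PT.id.snd.snd
  obtain ⟨body, P₁, h₁⟩ := hbody
  obtain ⟨tst, P₂, h₂⟩ := htest
  obtain ⟨L, hL⟩ := hl.esize_le
  have hloop : ∃ (p : Prog) (P : Polynomial ℕ), ∀ c, ∃ t, t ≤ P.eval (esize c) ∧
      Run p (enc (c, b c, l c)) (enc (c, (l c).foldl (f c) (b c), ([] : List α))) t := by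
    let S : Polynomial ℕ := .X + Q + L + 2
    let W : Polynomial ℕ := S + P₁.comp S + P₂.comp S
    refine ⟨.loop tst body, (L + 1) * (2 * W + 1), fun c => ?_⟩
    have hsz : ∀ l₁ l₂, l c = l₁ ++ l₂ →
        esize (c, l₁.foldl (f c) (b c), l₂) ≤ S.eval (esize c) := by
      intro l₁ l₂ e
      have h₁ := hQ c l₁ ⟨l₂, e.symm⟩
      have h₂ := hL c
      have h₃ := esize_append l₁ l₂
      have h₄ := esize_pos l₁
      rw [e] at h₂
      simp only [S, esize_pair, Polynomial.eval_add, Polynomial.eval_X, Polynomial.eval_ofNat]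
      omega
    have hW : W.eval (esize c) = S.eval (esize c) + P₁.eval (S.eval (esize c)) +
        P₂.eval (S.eval (esize c)) := by
      simp [W]
    obtain ⟨t, ht, r⟩ := run_loop_foldl (f := f c) (c := c) (tst := tst) (body := body)
      (W := W.eval (esize c)) (l c) (b c)
      (fun l₁ l₂ e => (hsz l₁ l₂ e).trans (by omega))
      (fun l₁ l₂ e => by
        obtain ⟨t, ht, r⟩ := h₂ (c, l₁.foldl (f c) (b c), l₂)
        have := eval_mono P₂ (hsz l₁ l₂ e)
        exact ⟨t, by omega, r⟩)
      (fun l₁ a l₂ e => by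
        obtain ⟨t, ht, r⟩ := h₁ (c, l₁.foldl (f c) (b c), a, l₂)
        have := eval_mono P₁ (hsz l₁ (a :: l₂) e)
        exact ⟨t, ht.trans (this.trans (by omega)), r⟩)
    refine ⟨t, ht.trans ?_, r⟩
    simp only [Polynomial.eval_mul, Polynomial.eval_add, Polynomial.eval_one,
      Polynomial.eval_ofNat]
    have h₁ := length_lt_esize (l c)
    have h₂ := hL c
    exact Nat.mul_le_mul_right _ (by omega)
  obtain ⟨p, P, hp⟩ := hloop
  obtain ⟨q, R, hq⟩ := (PT.id (α := γ)).pair (hb.pair hl)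
  obtain ⟨o, O, ho⟩ := (PT.id (α := γ × β × List α)).snd.fst
  refine ⟨.seq q (.seq p o), R + (P + O.comp P + 1) + 1, fun c => ?_⟩
  obtain ⟨s, hs, rs⟩ := hq c
  obtain ⟨t, ht, rt⟩ := hp c
  obtain ⟨u, hu, ru⟩ := ho (c, (l c).foldl (f c) (b c), [])
  refine ⟨_, ?_, .seq rs (.seq rt ru)⟩
  have := eval_mono O ((run_size_le rt).trans ht)
  simp only [Polynomial.eval_add, Polynomial.eval_comp, Polynomial.eval_one]
  unfold esize at *
  omega

theorem PT.reverse {l : γ → List α} (hl : PT l) : PT fun c => (l c).reverse := by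
  have aux : ∀ l acc : List α, l.foldl (fun acc a => a :: acc) acc = l.reverse ++ acc := by
    intro l
    induction l with
    | nil => simp
    | cons a l ih => intro acc; simp [ih]
  have : PT fun l : List α => l.foldl (fun acc a => a :: acc) [] := by
    refine PT.foldl (f := fun _ acc a => a :: acc) (PT.id.snd.snd.cons PT.id.snd.fst)
      (PT.const []) PT.id .X ?_
    rintro l l₁ ⟨l₂, rfl⟩
    have := esize_append l₁ l₂
    have := esize_pos l₂
    rw [aux, List.append_nil, esize_reverse, Polynomial.eval_X]
    omega
  simpa [aux] using this.comp hl

theorem PT.map {f : γ → α → β} {l : γ → List α} (hf : PT fun p : γ × α => f p.1 p.2)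
    (hl : PT l) : PT fun c => (l c).map (f c) := by
  have aux : ∀ c (l : List α) acc,
      l.foldl (fun acc a => f c a :: acc) acc = (l.map (f c)).reverse ++ acc := by
    intro c l
    induction l with
    | nil => simp
    | cons a l ih => intro acc; simp [ih]
  obtain ⟨P, hP⟩ := hf.esize_le
  obtain ⟨L, hL⟩ := hl.esize_le
  have : PT fun c => (l c).foldl (fun acc a => f c a :: acc) [] := by
    refine PT.foldl (f := fun c acc a => f c a :: acc)
      ((hf.comp (PT.id.fst.pair PT.id.snd.snd)).cons PT.id.snd.fst)
      (PT.const []) hl (L * (P.comp (.X + L + 1) + 1) + 1) ?_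
    rintro c l₁ ⟨l₂, e⟩
    rw [aux, List.append_nil, esize_reverse]
    have h₁ := length_lt_esize (l c)
    have h₂ := hL c
    have h₃ : l₁.length ≤ (l c).length := by rw [← e]; simp
    have : ∀ b ∈ l₁.map (f c), esize b ≤ P.eval (esize c + L.eval (esize c) + 1) := by
      intro b hb
      obtain ⟨a, ha, rfl⟩ := List.mem_map.1 hb
      refine (hP (c, a)).trans (eval_mono P ?_)
      have : esize a < esize (l c) := esize_le_of_mem (by rw [← e]; simp [ha])
      rw [esize_pair]
      omega
    refine (esize_list_le this).trans ?_
    simp only [Polynomial.eval_add, Polynomial.eval_mul, Polynomial.eval_comp,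
      Polynomial.eval_one, Polynomial.eval_X, List.length_map]
    gcongr
    omega
  simpa [aux] using this.reverse

theorem PT.filter {p : γ → α → Bool} {l : γ → List α} (hf : PT fun q : γ × α => p q.1 q.2)
    (hl : PT l) : PT fun c => (l c).filter (p c) := by
  have aux : ∀ c (l : List α) acc,
      l.foldl (fun acc a => bif p c a then a :: acc else acc) acc =
        (l.filter (p c)).reverse ++ acc := by
    intro c l
    induction l with
    | nil => simp
    | cons a l ih => intro acc; cases h : p c a <;> simp [ih, h]
  have hsz : ∀ c (l : List α), esize (l.filter (p c)) ≤ esize l := by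
    intro c l
    induction l with
    | nil => simp
    | cons a l ih => cases h : p c a <;> simp only [h, List.filter_cons, esize_cons] <;>
        simp [esize_cons] <;> omega
  obtain ⟨L, hL⟩ := hl.esize_le
  have : PT fun c => (l c).foldl (fun acc a => bif p c a then a :: acc else acc) [] := by
    refine PT.foldl (f := fun c acc a => bif p c a then a :: acc else acc)
      (PT.cond (hf.comp (PT.id.fst.pair PT.id.snd.snd)) (PT.id.snd.snd.cons PT.id.snd.fst)
        PT.id.snd.fst) (PT.const []) hl L ?_
    rintro c l₁ ⟨l₂, e⟩
    rw [aux, List.append_nil, esize_reverse]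
    have h₁ := hL c
    have h₂ := hsz c l₁
    have h₃ := esize_append l₁ l₂
    have h₄ := esize_pos l₂
    rw [← e] at h₁
    omega
  simpa [aux] using this.reverse

theorem PT.append {f g : γ → List α} (hf : PT f) (hg : PT g) : PT fun c => f c ++ g c := by
  have aux : ∀ l acc : List α, l.foldl (fun acc a => a :: acc) acc = l.reverse ++ acc := by
    intro l
    induction l with
    | nil => simp
    | cons a l ih => intro acc; simp [ih]
  obtain ⟨F, hF⟩ := hf.esize_le
  obtain ⟨G, hG⟩ := hg.esize_le
  have : PT fun c => (f c).reverse.foldl (fun acc a => a :: acc) (g c) := by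
    refine PT.foldl (f := fun _ acc a => a :: acc) (PT.id.snd.snd.cons PT.id.snd.fst)
      hg hf.reverse (F + G) ?_
    rintro c l₁ ⟨l₂, e⟩
    have h₁ := esize_append l₁ l₂
    have h₂ := esize_pos l₂
    have h₃ := esize_append l₁.reverse (g c)
    have h₄ := hF c
    have h₅ := hG c
    rw [e, esize_reverse] at h₁
    rw [esize_reverse] at h₃
    rw [aux, Polynomial.eval_add]
    omega
  simpa [aux] using this

theorem PT.flatten {l : γ → List (List α)} (hl : PT l) : PT fun c => (l c).flatten := by
  have aux : ∀ (l : List (List α)) acc, l.foldl (fun acc a => acc ++ a) acc = acc ++ l.flatten := by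
    intro l
    induction l with
    | nil => simp
    | cons a l ih => intro acc; simp [ih]
  have hsz : ∀ l : List (List α), esize l.flatten ≤ esize l := by
    intro l
    induction l with
    | nil => simp [esize_nil]
    | cons a l ih =>
      have := esize_append a l.flatten
      rw [List.flatten_cons, esize_cons]
      omega
  obtain ⟨L, hL⟩ := hl.esize_le
  have : PT fun c => (l c).foldl (fun acc a => acc ++ a) [] := by
    refine PT.foldl (f := fun _ acc a => acc ++ a) (PT.id.snd.fst.append PT.id.snd.snd)
      (PT.const []) hl L ?_
    rintro c l₁ ⟨l₂, e⟩
    rw [aux, List.nil_append]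
    have h₁ := hL c
    have h₂ := hsz l₁
    have h₃ := esize_append l₁ l₂
    have h₄ := esize_pos l₂
    rw [← e] at h₁
    omega
  simpa [aux] using this

theorem PT.flatMap {f : γ → α → List β} {l : γ → List α} (hf : PT fun p : γ × α => f p.1 p.2)
    (hl : PT l) : PT fun c => (l c).flatMap (f c) := by
  simpa [List.flatMap_def] using (PT.map hf hl).flatten

theorem PT.headD {l : γ → List α} {d : γ → α} (hl : PT l) (hd : PT d) :
    PT fun c => (l c).headD (d c) := by
  have := PT.listCases (g := fun _ a _ => a) hl hd PT.id.snd.fst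
  refine (congrArg PT (funext fun c => ?_)).mp this
  cases l c <;> rfl

theorem PT.tail {l : γ → List α} (hl : PT l) : PT fun c => (l c).tail := by
  have := PT.listCases (f := fun _ => []) (g := fun _ _ t => t) hl (PT.const _) PT.id.snd.snd
  refine (congrArg PT (funext fun c => ?_)).mp this
  cases l c <;> rfl

theorem PT.isEmpty {l : γ → List α} (hl : PT l) : PT fun c => (l c).isEmpty := by
  have := PT.listCases (f := fun _ => true) (g := fun _ _ _ => false) hl (PT.const _) (PT.const _)
  refine (congrArg PT (funext fun c => ?_)).mp this
  cases l c <;> rfl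

theorem PT.succ {f : γ → ℕ} (hf : PT f) : PT fun c => f c + 1 :=
  PT.comp (g := fun p : Unit × ℕ => p.2 + 1) (PT.of_enc_eq fun _ => rfl) ((PT.const ()).pair hf)

theorem PT.length {l : γ → List α} (hl : PT l) : PT fun c => (l c).length := by
  have h₁ := PT.map (f := fun _ _ => ()) (PT.const ()) hl
  have h₂ : PT fun l : List Unit => l.length := by
    refine PT.of_enc_eq fun l => ?_
    induction l with
    | nil => rfl
    | cons a l ih => rw [List.length_cons, enc_succ, ih]; rfl
  simpa using h₂.comp h₁

theorem PT.replicate {n : γ → ℕ} (hn : PT n) : PT fun c => List.replicate (n c) () := by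
  refine PT.comp (g := fun n : ℕ => List.replicate n ()) (PT.of_enc_eq fun n => ?_) hn
  induction n with
  | zero => rfl
  | succ n ih => rw [enc_succ, ← ih]; rfl

theorem PT.iterate {f : γ → β → β} {b : γ → β} {n : γ → ℕ} (hf : PT fun p : γ × β => f p.1 p.2)
    (hb : PT b) (hn : PT n) (Q : Polynomial ℕ)
    (hQ : ∀ c i, i ≤ n c → esize ((f c)^[i] (b c)) ≤ Q.eval (esize c)) :
    PT fun c => (f c)^[n c] (b c) := by
  have aux : ∀ c (l : List Unit) b, l.foldl (fun b _ => f c b) b = (f c)^[l.length] b := by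
    intro c l
    induction l with
    | nil => simp
    | cons a l ih => intro b; simp [ih]
  have := PT.foldl (f := fun c b (_ : Unit) => f c b) (hf.comp (PT.id.fst.pair PT.id.snd.fst)) hb
    hn.replicate Q (by
      rintro c l₁ h
      rw [aux]
      refine hQ c _ ?_
      simpa using h.length_le)
  simpa [aux] using this

theorem PT.add {f g : γ → ℕ} (hf : PT f) (hg : PT g) : PT fun c => f c + g c := by
  simpa using (hf.replicate.append hg.replicate).length

theorem PT.sub {f g : γ → ℕ} (hf : PT f) (hg : PT g) : PT fun c => f c - g c := by
  have aux : ∀ n i : ℕ, (fun m : ℕ => m - 1)^[i] n = n - i := by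
    intro n i
    induction i with
    | zero => rfl
    | succ i ih => rw [Function.iterate_succ_apply', ih]; omega
  have hpred : PT fun n : ℕ => n - 1 := by
    simpa using (PT.id (α := ℕ)).replicate.tail.length
  obtain ⟨F, hF⟩ := hf.esize_le
  have := PT.iterate (f := fun _ m => m - 1) (hpred.comp PT.id.snd) hf hg F (by
    intro c i _
    have := hF c
    rw [aux]
    rw [esize_nat] at *
    omega)
  simpa [aux] using this

theorem PT.mul {f g : γ → ℕ} (hf : PT f) (hg : PT g) : PT fun c => f c * g c := by
  have := (PT.flatMap (f := fun (c : γ) (_ : Unit) => List.replicate (g c) ())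
    (hg.comp PT.id.fst).replicate hf.replicate).length
  simpa [List.length_flatMap] using this

theorem PT.and {f g : γ → Bool} (hf : PT f) (hg : PT g) : PT fun c => f c && g c := by
  simpa using hf.cond hg (PT.const false)

theorem PT.or {f g : γ → Bool} (hf : PT f) (hg : PT g) : PT fun c => f c || g c := by
  simpa using hf.cond (PT.const true) hg

theorem PT.not {f : γ → Bool} (hf : PT f) : PT fun c => !f c := by
  refine (congrArg PT (funext fun c => ?_)).mp (hf.cond (PT.const false) (PT.const true))
  cases f c <;> rfl

theorem PT.le {f g : γ → ℕ} (hf : PT f) (hg : PT g) : PT fun c => decide (f c ≤ g c) := by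
  refine (congrArg PT (funext fun c => ?_)).mp (hf.sub hg).replicate.isEmpty
  rw [Bool.eq_iff_iff]
  simp [Nat.sub_eq_zero_iff_le]

theorem PT.lt {f g : γ → ℕ} (hf : PT f) (hg : PT g) : PT fun c => decide (f c < g c) :=
  hf.succ.le hg

theorem PT.eq {f g : γ → ℕ} (hf : PT f) (hg : PT g) : PT fun c => decide (f c = g c) := by
  refine (congrArg PT (funext fun c => ?_)).mp ((hf.le hg).and (hg.le hf))
  rw [Bool.eq_iff_iff]
  simp
  omega

theorem PT.decide_and {p q : γ → Prop} [DecidablePred p] [DecidablePred q]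
    (hp : PT fun c => decide (p c)) (hq : PT fun c => decide (q c)) :
    PT fun c => decide (p c ∧ q c) := by
  simpa using hp.and hq

theorem PT.decide_or {p q : γ → Prop} [DecidablePred p] [DecidablePred q]
    (hp : PT fun c => decide (p c)) (hq : PT fun c => decide (q c)) :
    PT fun c => decide (p c ∨ q c) := by
  simpa using hp.or hq

theorem PT.decide_not {p : γ → Prop} [DecidablePred p]
    (hp : PT fun c => decide (p c)) : PT fun c => decide (¬ p c) := by
  simpa using hp.not

theorem PT.countP {p : γ → α → Bool} {l : γ → List α} (hf : PT fun q : γ × α => p q.1 q.2)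
    (hl : PT l) : PT fun c => (l c).countP (p c) := by
  simpa [List.countP_eq_length_filter] using (PT.filter hf hl).length

theorem PT.all {p : γ → α → Bool} {l : γ → List α} (hf : PT fun q : γ × α => p q.1 q.2)
    (hl : PT l) : PT fun c => (l c).all (p c) := by
  refine (congrArg PT (funext fun c => ?_)).mp
    (PT.filter (p := fun c a => !p c a) hf.not hl).isEmpty
  rw [Bool.eq_iff_iff]
  simp

theorem PT.range {n : γ → ℕ} (hn : PT n) : PT fun c => List.range (n c) := by
  have aux : ∀ i, (fun l : List ℕ => l ++ [l.length])^[i] [] = List.range i := by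
    intro i
    induction i with
    | zero => rfl
    | succ i ih => rw [Function.iterate_succ_apply', ih, List.range_succ]; simp
  obtain ⟨N, hN⟩ := hn.esize_le
  have := PT.iterate (f := fun _ (l : List ℕ) => l ++ [l.length]) (b := fun _ => [])
    (PT.id.snd.append (PT.id.snd.length.cons (PT.const []))) (PT.const []) hn
    (N * (N + 1) + 1) (by
      intro c i hi
      have h₁ := hN c
      rw [esize_nat] at h₁
      rw [aux]
      refine (esize_list_le (B := N.eval (esize c)) fun a ha => ?_).trans ?_
      · rw [esize_nat]
        have := List.mem_range.1 ha
        omega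
      · simp only [Polynomial.eval_add, Polynomial.eval_mul, Polynomial.eval_one,
          List.length_range]
        gcongr
        omega)
  simpa [aux] using this

theorem PT.getD {l : γ → List α} {i : γ → ℕ} {d : γ → α} (hl : PT l) (hi : PT i) (hd : PT d) :
    PT fun c => (l c).getD (i c) (d c) := by
  have aux : ∀ (l : List α) i, List.tail^[i] l = l.drop i := by
    intro l i
    induction i generalizing l with
    | zero => rfl
    | succ i ih => rw [Function.iterate_succ_apply, ih]; cases l <;> simp
  obtain ⟨L, hL⟩ := hl.esize_le
  have := PT.iterate (f := fun _ (l : List α) => l.tail) PT.id.snd.tail hl hi L (by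
    intro c j _
    rw [aux]
    have h₁ := esize_append ((l c).take j) ((l c).drop j)
    rw [List.take_append_drop] at h₁
    have := hL c
    have := esize_pos ((l c).take j)
    omega)
  refine (congrArg PT (funext fun c => ?_)).mp (this.headD hd)
  simp [aux, List.headD_eq_head?_getD, List.head?_drop, List.getD_eq_getElem?_getD]

end PolyTimeData

/-! ### The algorithm on lists -/

namespace OnlinePacking

open PolyTimeData PolyTimeData.Enc

/-- A vertex is recorded as its source server, the label of its component, and its current
server. -/
abbrev Rec : Type := ℕ × ℕ × ℕ

/-- Number of vertices with label `a`. -/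
def sizeL (L : List Rec) (a : ℕ) : ℕ := L.countP fun r => decide (r.2.1 = a)

/-- Number of vertices on the server `s`. -/
def loadL (L : List Rec) (s : ℕ) : ℕ := L.countP fun r => decide (r.2.2 = s)

/-- Number of vertices with label `a` whose source is not `s`. -/
def foreignL (L : List Rec) (a s : ℕ) : ℕ :=
  L.countP fun r => decide (r.2.1 = a ∧ ¬ r.1 = s)

/-- The class `a` is merged into the class `b`, and moves to the server `t`. -/
def mergeL (L : List Rec) (a b t : ℕ) : List Rec :=
  L.map fun r => if r.2.1 = a then (r.1, b, t) else r

/-- The first server on which fewer than half as many vertices of the class `b` are foreign as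
on `t`; if there is none, `t` itself. -/
def homeL (ℓ : ℕ) (L : List Rec) (b t : ℕ) : ℕ :=
  ((List.range ℓ).filter fun s => decide (2 * foreignL L b s < foreignL L b t)).headD t

/-- The class `b` moves to the server `s`. -/
def moveL (L : List Rec) (b s : ℕ) : List Rec :=
  L.map fun r => if r.2.1 = b then (r.1, r.2.1, s) else r

/-- Every server has volume at most `1 + 8 / M`. -/
def fitsL (M k ℓ : ℕ) (L : List Rec) : Bool :=
  (List.range ℓ).all fun s => decide (M * loadL L s ≤ (M + 8) * k)

/-- The elementary operation `(a, j, s, s')`: the class `a`, and the small classes with label below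
`j` on the server `s`, move to `s'`. -/
def shiftL (M k : ℕ) (L : List Rec) (q : ℕ × ℕ × ℕ × ℕ) : List Rec :=
  L.map fun r =>
    if r.2.1 = q.1 ∨ (r.2.2 = q.2.2.1 ∧ r.2.1 < q.2.1 ∧ M * sizeL L r.2.1 < k) then
      (r.1, r.2.1, q.2.2.2) else r

/-- The parameters of elementary operations. -/
def paramsL (ℓ n : ℕ) : List (ℕ × ℕ × ℕ × ℕ) :=
  (List.range (n + 1)).flatMap fun a => (List.range (n + 1)).flatMap fun j =>
    (List.range ℓ).flatMap fun s => (List.range ℓ).map fun s' => (a, j, s, s')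

/-- The results of `N` elementary operations. -/
def candidatesL (M k ℓ : ℕ) (L : List Rec) : ℕ → List (List Rec)
  | 0 => [L]
  | N + 1 => (candidatesL M k ℓ L N).flatMap fun L' =>
      (paramsL ℓ L'.length).map (shiftL M k L')

/-- The assignment in `L'` unloads `t` to volume at most `1 + 4 / M`, and does not load any other
server to a volume of more than that, unless this volume does not increase. -/
def improvesL (M k ℓ t : ℕ) (L L' : List Rec) : Bool :=
  (List.range ℓ).all fun s =>
    decide (M * loadL L' s ≤ (M + 4) * k ∨ (¬ s = t ∧ loadL L' s ≤ loadL L s))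

/-- The first improvement among the results of `N` elementary operations. -/
def repackL (M N k ℓ t : ℕ) (L : List Rec) : List Rec :=
  ((candidatesL M k ℓ L N).filter (improvesL M k ℓ t L)).headD L

/-- The reaction to a merger of the class `a` into the class `b` located at `t`. The bit tells
whether the algorithm is still in its first phase. -/
def joinL (M N k ℓ : ℕ) (phase : Bool) (L : List Rec) (a b t : ℕ) : Bool × List Rec :=
  bif phase && fitsL M k ℓ (moveL (mergeL L a b t) b (homeL ℓ (mergeL L a b t) b t)) then
    (true, moveL (mergeL L a b t) b (homeL ℓ (mergeL L a b t) b t))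
  else bif fitsL M k ℓ (mergeL L a b t) then (false, mergeL L a b t)
  else (false, repackL M N k ℓ t (mergeL L a b t))

/-- The record of the vertex `u`. -/
def lookup (L : List Rec) (u : ℕ) : Rec := L.getD u (0, 0, 0)

/-- The reaction to an edge: if it joins two classes, the smaller one is merged into the larger
one. -/
def stepL (M N k ℓ : ℕ) (S : Bool × List Rec) (e : ℕ × ℕ) : Bool × List Rec :=
  if (lookup S.2 e.1).2.1 = (lookup S.2 e.2).2.1 then S
  else if sizeL S.2 (lookup S.2 e.1).2.1 ≤ sizeL S.2 (lookup S.2 e.2).2.1 then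
    joinL M N k ℓ S.1 S.2 (lookup S.2 e.1).2.1 (lookup S.2 e.2).2.1 (lookup S.2 e.2).2.2
  else joinL M N k ℓ S.1 S.2 (lookup S.2 e.2).2.1 (lookup S.2 e.1).2.1 (lookup S.2 e.1).2.2

/-- Initially, every vertex is its own label, and is on its source server. -/
def initL (src : List ℕ) : List Rec :=
  (List.range src.length).map fun i => (src.getD i 0, i, src.getD i 0)

/-- The state after the given requests. -/
def runL (M N k ℓ : ℕ) (src : List ℕ) (es : List (ℕ × ℕ)) : Bool × List Rec :=
  es.foldl (stepL M N k ℓ) (true, initL src)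

/-! ### The algorithm runs in polynomial time -/

section Time

variable {γ : Type} [Enc γ] {k ℓ a b t : γ → ℕ} {L L' : γ → List Rec}

theorem PT_sizeL (hL : PT L) (ha : PT a) : PT fun c => sizeL (L c) (a c) :=
  PT.countP (p := fun c (r : Rec) => decide (r.2.1 = a c)) (PT.id.snd.snd.fst.eq (ha.comp PT.id.fst)) hL

theorem PT_loadL (hL : PT L) (ha : PT a) : PT fun c => loadL (L c) (a c) :=
  PT.countP (p := fun c (r : Rec) => decide (r.2.2 = a c)) (PT.id.snd.snd.snd.eq (ha.comp PT.id.fst)) hL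

theorem PT_foreignL (hL : PT L) (ha : PT a) (hb : PT b) :
    PT fun c => foreignL (L c) (a c) (b c) :=
  PT.countP (p := fun c (r : Rec) => decide (r.2.1 = a c ∧ ¬ r.1 = b c))
    (PT.decide_and (PT.id.snd.snd.fst.eq (ha.comp PT.id.fst))
      (PT.decide_not (PT.id.snd.fst.eq (hb.comp PT.id.fst)))) hL

theorem PT_mergeL (hL : PT L) (ha : PT a) (hb : PT b) (ht : PT t) :
    PT fun c => mergeL (L c) (a c) (b c) (t c) :=
  PT.map (f := fun c (r : Rec) => if r.2.1 = a c then (r.1, b c, t c) else r)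
    (PT.ite (PT.id.snd.snd.fst.eq (ha.comp PT.id.fst))
      (PT.id.snd.fst.pair ((hb.comp PT.id.fst).pair (ht.comp PT.id.fst))) PT.id.snd) hL

theorem PT_homeL (hℓ : PT ℓ) (hL : PT L) (hb : PT b) (ht : PT t) :
    PT fun c => homeL (ℓ c) (L c) (b c) (t c) := by
  have hL' : PT fun q : γ × ℕ => L q.1 := hL.comp PT.id.fst
  have hb' : PT fun q : γ × ℕ => b q.1 := hb.comp PT.id.fst
  exact (PT.filter (p := fun c s => decide (2 * foreignL (L c) (b c) s <
      foreignL (L c) (b c) (t c)))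
    (((PT.const 2).mul (PT_foreignL hL' hb' PT.id.snd)).lt
      (PT_foreignL hL' hb' (ht.comp PT.id.fst))) hℓ.range).headD ht

theorem PT_moveL (hL : PT L) (hb : PT b) (ht : PT t) :
    PT fun c => moveL (L c) (b c) (t c) :=
  PT.map (f := fun c (r : Rec) => if r.2.1 = b c then (r.1, r.2.1, t c) else r)
    (PT.ite (PT.id.snd.snd.fst.eq (hb.comp PT.id.fst))
      (PT.id.snd.fst.pair (PT.id.snd.snd.fst.pair (ht.comp PT.id.fst))) PT.id.snd) hL

theorem PT_fitsL (M : ℕ) (hk : PT k) (hℓ : PT ℓ) (hL : PT L) :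
    PT fun c => fitsL M (k c) (ℓ c) (L c) :=
  PT.all (p := fun c s => decide (M * loadL (L c) s ≤ (M + 8) * k c))
    (((PT.const M).mul (PT_loadL (hL.comp PT.id.fst) PT.id.snd)).le
      ((PT.const (M + 8)).mul (hk.comp PT.id.fst))) hℓ.range

theorem PT_shiftL (M : ℕ) (hk : PT k) (hL : PT L) {q : γ → ℕ × ℕ × ℕ × ℕ} (hq : PT q) :
    PT fun c => shiftL M (k c) (L c) (q c) := by
  have hq' : PT fun p : γ × Rec => q p.1 := hq.comp PT.id.fst
  have hr : PT fun p : γ × Rec => p.2 := PT.id.snd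
  exact PT.map (f := fun c (r : Rec) => if r.2.1 = (q c).1 ∨ (r.2.2 = (q c).2.2.1 ∧ r.2.1 < (q c).2.1 ∧
      M * sizeL (L c) r.2.1 < k c) then (r.1, r.2.1, (q c).2.2.2) else r)
    (PT.ite (PT.decide_or (hr.snd.fst.eq hq'.fst) (PT.decide_and (hr.snd.snd.eq hq'.snd.snd.fst)
        (PT.decide_and (hr.snd.fst.lt hq'.snd.fst)
          (((PT.const M).mul (PT_sizeL (hL.comp PT.id.fst) hr.snd.fst)).lt
            (hk.comp PT.id.fst)))))
      (hr.fst.pair (hr.snd.fst.pair hq'.snd.snd.snd)) hr) hL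

theorem PT_paramsL {n : γ → ℕ} (hℓ : PT ℓ) (hn : PT n) : PT fun c => paramsL (ℓ c) (n c) := by
  refine PT.flatMap (f := fun c a => (List.range (n c + 1)).flatMap fun j =>
    (List.range (ℓ c)).flatMap fun s => (List.range (ℓ c)).map fun s' => (a, j, s, s'))
    ?_ hn.succ.range
  refine PT.flatMap (f := fun (c : γ × ℕ) j =>
    (List.range (ℓ c.1)).flatMap fun s => (List.range (ℓ c.1)).map fun s' => (c.2, j, s, s'))
    ?_ (hn.comp PT.id.fst).succ.range
  refine PT.flatMap (f := fun (c : (γ × ℕ) × ℕ) s =>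
    (List.range (ℓ c.1.1)).map fun s' => (c.1.2, c.2, s, s'))
    ?_ (hℓ.comp PT.id.fst.fst).range
  exact PT.map (f := fun (c : ((γ × ℕ) × ℕ) × ℕ) s' => (c.1.1.2, c.1.2, c.2, s'))
    (PT.id.fst.fst.fst.snd.pair (PT.id.fst.fst.snd.pair (PT.id.fst.snd.pair PT.id.snd)))
    (hℓ.comp PT.id.fst.fst.fst).range

theorem PT_candidatesL (M N : ℕ) (hk : PT k) (hℓ : PT ℓ) (hL : PT L) :
    PT fun c => candidatesL M (k c) (ℓ c) (L c) N := by
  induction N with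
  | zero => exact hL.cons (PT.const [])
  | succ N ih =>
    refine PT.flatMap (f := fun c L' => (paramsL (ℓ c) L'.length).map (shiftL M (k c) L')) ?_ ih
    exact PT.map (f := fun (c : γ × List Rec) q => shiftL M (k c.1) c.2 q)
      (PT_shiftL M (hk.comp PT.id.fst.fst) PT.id.fst.snd PT.id.snd)
      (PT_paramsL (hℓ.comp PT.id.fst) PT.id.snd.length)

theorem PT_improvesL (M : ℕ) (hk : PT k) (hℓ : PT ℓ) (ht : PT t) (hL : PT L) (hL' : PT L') :
    PT fun c => improvesL M (k c) (ℓ c) (t c) (L c) (L' c) := by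
  have h : PT fun q : γ × ℕ => loadL (L' q.1) q.2 := PT_loadL (hL'.comp PT.id.fst) PT.id.snd
  exact PT.all (p := fun c s => decide (M * loadL (L' c) s ≤ (M + 4) * k c ∨
      (¬ s = t c ∧ loadL (L' c) s ≤ loadL (L c) s)))
    (PT.decide_or (((PT.const M).mul h).le ((PT.const (M + 4)).mul (hk.comp PT.id.fst)))
      (PT.decide_and (PT.decide_not (PT.id.snd.eq (ht.comp PT.id.fst)))
        (h.le (PT_loadL (hL.comp PT.id.fst) PT.id.snd)))) hℓ.range

theorem PT_repackL (M N : ℕ) (hk : PT k) (hℓ : PT ℓ) (ht : PT t) (hL : PT L) :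
    PT fun c => repackL M N (k c) (ℓ c) (t c) (L c) :=
  (PT.filter (p := fun c => improvesL M (k c) (ℓ c) (t c) (L c))
    (PT_improvesL M (hk.comp PT.id.fst) (hℓ.comp PT.id.fst) (ht.comp PT.id.fst)
      (hL.comp PT.id.fst) PT.id.snd) (PT_candidatesL M N hk hℓ hL)).headD hL

theorem PT_joinL (M N : ℕ) {p : γ → Bool} (hk : PT k) (hℓ : PT ℓ) (hp : PT p) (hL : PT L)
    (ha : PT a) (hb : PT b) (ht : PT t) :
    PT fun c => joinL M N (k c) (ℓ c) (p c) (L c) (a c) (b c) (t c) := by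
  have h₁ := PT_mergeL hL ha hb ht
  have h₂ := PT_moveL h₁ hb (PT_homeL hℓ h₁ hb ht)
  exact PT.cond (hp.and (PT_fitsL M hk hℓ h₂)) ((PT.const true).pair h₂)
    (PT.cond (PT_fitsL M hk hℓ h₁) ((PT.const false).pair h₁)
      ((PT.const false).pair (PT_repackL M N hk hℓ ht h₁)))

theorem PT_lookup (hL : PT L) (ha : PT a) : PT fun c => lookup (L c) (a c) :=
  hL.getD ha (PT.const _)

theorem PT_stepL (M N : ℕ) {S : γ → Bool × List Rec} {e : γ → ℕ × ℕ} (hk : PT k) (hℓ : PT ℓ)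
    (hS : PT S) (he : PT e) : PT fun c => stepL M N (k c) (ℓ c) (S c) (e c) := by
  have h₁ := PT_lookup hS.snd he.fst
  have h₂ := PT_lookup hS.snd he.snd
  exact PT.ite (h₁.snd.fst.eq h₂.snd.fst) hS
    (PT.ite ((PT_sizeL hS.snd h₁.snd.fst).le (PT_sizeL hS.snd h₂.snd.fst))
      (PT_joinL M N hk hℓ hS.fst hS.snd h₁.snd.fst h₂.snd.fst h₂.snd.snd)
      (PT_joinL M N hk hℓ hS.fst hS.snd h₂.snd.fst h₁.snd.fst h₁.snd.snd))

theorem PT_initL {s : γ → List ℕ} (hs : PT s) : PT fun c => initL (s c) := by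
  have h : PT fun q : γ × ℕ => (s q.1).getD q.2 0 :=
    (hs.comp PT.id.fst).getD PT.id.snd (PT.const 0)
  exact PT.map (f := fun c i => ((s c).getD i 0, i, (s c).getD i 0))
    (h.pair (PT.id.snd.pair h)) hs.length.range

end Time

/-- There are `n` records, and no number in them is larger than `B`. -/
def Bounded (n B : ℕ) (L : List Rec) : Prop :=
  L.length = n ∧ ∀ r ∈ L, r.1 ≤ B ∧ r.2.1 ≤ B ∧ r.2.2 ≤ B

theorem Bounded.map {n B : ℕ} {L : List Rec} (h : Bounded n B L) {f : Rec → Rec}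
    (hf : ∀ r, r.1 ≤ B ∧ r.2.1 ≤ B ∧ r.2.2 ≤ B → (f r).1 ≤ B ∧ (f r).2.1 ≤ B ∧ (f r).2.2 ≤ B) :
    Bounded n B (L.map f) := by
  refine ⟨by simpa using h.1, fun r hr => ?_⟩
  obtain ⟨r', hr', rfl⟩ := List.mem_map.1 hr
  exact hf r' (h.2 r' hr')

theorem Bounded.esize_le {n B : ℕ} {L : List Rec} (h : Bounded n B L) :
    esize L ≤ n * (6 * B + 6) + 1 := by
  refine (esize_list_le (B := 6 * B + 5) fun r hr => ?_).trans (by rw [h.1])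
  obtain ⟨h₁, h₂, h₃⟩ := h.2 r hr
  obtain ⟨a, b, c⟩ := r
  simp only [esize_pair, esize_nat] at *
  omega

theorem Bounded.lookup {n B : ℕ} {L : List Rec} (h : Bounded n B L) (u : ℕ) :
    (lookup L u).2.1 ≤ B ∧ (lookup L u).2.2 ≤ B := by
  unfold OnlinePacking.lookup
  by_cases hu : u < L.length
  · rw [List.getD_eq_getElem _ _ hu]
    exact (h.2 _ (List.getElem_mem hu)).2
  · rw [List.getD_eq_default _ _ (not_lt.1 hu)]
    simp

theorem headD_filter {α : Type} (l : List α) (p : α → Bool) (d : α) :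
    (l.filter p).headD d ∈ l ∧ p ((l.filter p).headD d) = true ∨
      (l.filter p).headD d = d ∧ ∀ x ∈ l, p x = false := by
  cases h : l.filter p with
  | nil => exact .inr ⟨rfl, fun x hx => by simpa using List.filter_eq_nil_iff.1 h x hx⟩
  | cons a l' => exact .inl (List.mem_filter.1 (by rw [h]; simp))

theorem homeL_le {ℓ b t B : ℕ} (L : List Rec) (hℓ : ℓ ≤ B) (ht : t ≤ B) : homeL ℓ L b t ≤ B := by
  rcases headD_filter (List.range ℓ)
    (fun s => decide (2 * foreignL L b s < foreignL L b t)) t with h | h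
  · exact (List.mem_range.1 h.1).le.trans hℓ
  · exact h.1.le.trans ht

theorem Bounded.merge {n B a b t : ℕ} {L : List Rec} (h : Bounded n B L) (hb : b ≤ B)
    (ht : t ≤ B) : Bounded n B (mergeL L a b t) :=
  h.map fun r hr => by
    split_ifs
    exacts [⟨hr.1, hb, ht⟩, hr]

theorem Bounded.candidates {M k ℓ n B N : ℕ} {L L' : List Rec} (h : Bounded n B L) (hℓ : ℓ ≤ B)
    (hL' : L' ∈ candidatesL M k ℓ L N) : Bounded n B L' := by
  induction N generalizing L' with
  | zero => rw [candidatesL, List.mem_singleton] at hL'; rwa [hL']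
  | succ N ih =>
    obtain ⟨L₁, h₁, h₂⟩ := List.mem_flatMap.1 hL'
    obtain ⟨q, hq, rfl⟩ := List.mem_map.1 h₂
    refine (ih h₁).map fun r hr => ?_
    have : q.2.2.2 < ℓ := by
      simp only [paramsL, List.mem_flatMap, List.mem_map, List.mem_range] at hq
      obtain ⟨_, _, _, _, _, _, s', hs', rfl⟩ := hq
      exact hs'
    split_ifs
    exacts [⟨hr.1, hr.2.1, by simp only; omega⟩, hr]

theorem Bounded.join {M N k ℓ n B a b t : ℕ} {p : Bool} {L : List Rec} (h : Bounded n B L)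
    (hℓ : ℓ ≤ B) (hb : b ≤ B) (ht : t ≤ B) : Bounded n B (joinL M N k ℓ p L a b t).2 := by
  have h₁ := h.merge (a := a) hb ht
  unfold joinL
  simp only [Bool.cond_eq_ite]
  split_ifs
  · refine h₁.map fun r hr => ?_
    split_ifs
    exacts [⟨hr.1, hr.2.1, homeL_le _ hℓ ht⟩, hr]
  · exact h₁
  · rcases headD_filter (candidatesL M k ℓ (mergeL L a b t) N)
      (improvesL M k ℓ t (mergeL L a b t)) (mergeL L a b t) with h₂ | h₂
    · exact h₁.candidates hℓ h₂.1
    · unfold repackL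
      rw [h₂.1]
      exact h₁

theorem Bounded.step {M N k ℓ n B : ℕ} {S : Bool × List Rec} (e : ℕ × ℕ) (h : Bounded n B S.2)
    (hℓ : ℓ ≤ B) : Bounded n B (stepL M N k ℓ S e).2 := by
  unfold stepL
  split_ifs
  · exact h
  · exact h.join hℓ (h.lookup _).1 (h.lookup _).2
  · exact h.join hℓ (h.lookup _).1 (h.lookup _).2

theorem Bounded.init {B : ℕ} {src : List ℕ} (hn : src.length ≤ B) (hs : ∀ s ∈ src, s ≤ B) :
    Bounded src.length B (initL src) := by
  refine ⟨by simp [initL], fun r hr => ?_⟩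
  obtain ⟨i, hi, rfl⟩ := List.mem_map.1 hr
  have hi := List.mem_range.1 hi
  rw [List.getD_eq_getElem _ _ hi]
  have := hs _ (List.getElem_mem hi)
  exact ⟨this, by simp only; omega, this⟩

/-- The states of a run have polynomial size, since the records are bounded throughout. -/
theorem PT_runL (M N : ℕ) :
    PT fun c : ℕ × ℕ × List ℕ × List (ℕ × ℕ) =>
      (runL M N c.1 c.2.1 c.2.2.1 c.2.2.2).2.map fun r => r.2.2 := by
  refine PT.map (f := fun _ (r : Rec) => r.2.2) PT.id.snd.snd.snd (PT.snd ?_)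
  refine PT.foldl (f := fun (c : ℕ × ℕ × List ℕ × List (ℕ × ℕ)) S e => stepL M N c.1 c.2.1 S e)
    (b := fun c => (true, initL c.2.2.1))
    (PT_stepL M N PT.id.fst.fst PT.id.fst.snd.fst PT.id.snd.fst PT.id.snd.snd)
    ((PT.const true).pair (PT_initL PT.id.snd.snd.fst)) PT.id.snd.snd.snd
    (.X * (6 * .X + 6) + 5) ?_
  rintro ⟨k, ℓ, src, es⟩ l -
  have hB : esize (k, ℓ, src, es) = esize k + (esize ℓ + (esize src + esize es + 1) + 1) + 1 := rfl
  set B := esize (k, ℓ, src, es)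
  have hn := length_lt_esize src
  have hℓ := esize_nat ℓ
  have key : ∀ (l : List (ℕ × ℕ)) (S : Bool × List Rec), Bounded src.length B S.2 →
      Bounded src.length B (l.foldl (stepL M N k ℓ) S).2 := by
    intro l
    induction l with
    | nil => exact fun S h => h
    | cons e l ih => exact fun S h => ih _ (h.step e (by omega))
  have h := (key l (true, initL src) (Bounded.init (by omega) fun s hs => by
    have h₁ := esize_le_of_mem hs
    rw [esize_nat] at h₁
    omega)).esize_le
  simp only [Polynomial.eval_add, Polynomial.eval_mul, Polynomial.eval_X,
    Polynomial.eval_ofNat]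
  have hb : ∀ S : Bool × List Rec, esize S ≤ esize S.2 + 4 := by
    rintro ⟨b, L⟩
    simp only [esize_pair]
    have : esize b ≤ 3 := by cases b <;> simp [esize, enc, WhileLang.Data.size]
    omega
  refine (hb _).trans ?_
  refine (Nat.add_le_add_right h 4).trans ?_
  have : src.length * (6 * B + 6) ≤ B * (6 * B + 6) := Nat.mul_le_mul_right _ (by omega)
  omega

end OnlinePacking

/-! ### The states of the algorithm as functions on the vertices -/

namespace OnlinePacking

open GraphPartitioning

variable {n ℓ : ℕ}

/-- The records of the vertices for sources `src`, labels `lab` and servers `σ`. -/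
def record (src : Fin n → Fin ℓ) (lab : Fin n → Fin n) (σ : Fin n → Fin ℓ) : List Rec :=
  List.ofFn fun v => ((src v).val, (lab v).val, (σ v).val)

/-- Number of vertices with label `a`. -/
def classSize (lab : Fin n → Fin n) (a : Fin n) : ℕ := (Finset.univ.filter fun v => lab v = a).card

/-- Number of vertices with label `a` whose source is not `s`. -/
def foreign (src : Fin n → Fin ℓ) (lab : Fin n → Fin n) (a : Fin n) (s : Fin ℓ) : ℕ :=
  (Finset.univ.filter fun v => lab v = a ∧ ¬ src v = s).card

/-- The labels after the class `a` is merged into the class `b`. -/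
def mergeLab (lab : Fin n → Fin n) (a b : Fin n) : Fin n → Fin n :=
  fun v => if lab v = a then b else lab v

/-- The assignment after the class `a` moves to the server `t`. -/
def moveClass (lab : Fin n → Fin n) (σ : Fin n → Fin ℓ) (a : Fin n) (t : Fin ℓ) : Fin n → Fin ℓ :=
  fun v => if lab v = a then t else σ v

/-- Every server has volume at most `1 + 8 / M`. -/
def Fits (M k : ℕ) (σ : Fin n → Fin ℓ) : Prop := ∀ s, M * load σ s ≤ (M + 8) * k

/-- The elementary operation `(a, j, s, s')`: the class `a`, and the small classes with label below
`j` on the server `s`, move to `s'`. -/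
def shift (M k : ℕ) (lab : Fin n → Fin n) (σ : Fin n → Fin ℓ) (a j : ℕ) (s s' : Fin ℓ) :
    Fin n → Fin ℓ :=
  fun v => if (lab v).val = a ∨ (σ v = s ∧ (lab v).val < j ∧ M * classSize lab (lab v) < k)
    then s' else σ v

/-- `Reach M k lab N σ σ'`: the assignment `σ'` results from `σ` by `N` elementary operations. -/
def Reach (M k : ℕ) (lab : Fin n → Fin n) : ℕ → (Fin n → Fin ℓ) → (Fin n → Fin ℓ) → Prop
  | 0, σ, σ' => σ' = σ
  | N + 1, σ, σ' => ∃ σ₁, Reach M k lab N σ σ₁ ∧ ∃ a j : ℕ, a ≤ n ∧ j ≤ n ∧ ∃ s s',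
      σ' = shift M k lab σ₁ a j s s'

/-- The assignment `σ'` unloads `t` to volume at most `1 + 4 / M`, and does not load any other
server to a volume of more than that, unless this volume does not increase. -/
def Improves (M k : ℕ) (t : Fin ℓ) (σ σ' : Fin n → Fin ℓ) : Prop :=
  ∀ s, M * load σ' s ≤ (M + 4) * k ∨ (¬ s = t ∧ load σ' s ≤ load σ s)

/-- The server `s` is a new home for the class `b`, which is on `t`: either fewer than half as many
vertices of the class are foreign on `s` as on `t`, or `s = t` and there is no such server. -/
def IsHome (src : Fin n → Fin ℓ) (lab : Fin n → Fin n) (b : Fin n) (t s : Fin ℓ) : Prop :=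
  2 * foreign src lab b s < foreign src lab b t ∨
    s = t ∧ ∀ s', ¬ 2 * foreign src lab b s' < foreign src lab b t

/-- `Joins M N k src lab a b t p σ p' σ'`: if the class `a` is merged into the class `b` located at
`t`, then the phase `p` and the assignment `σ` may change to `p'` and `σ'`. Here `lab` are the
labels before the merger. -/
inductive Joins (M N k : ℕ) (src : Fin n → Fin ℓ) (lab : Fin n → Fin n) (a b : Fin n)
    (t : Fin ℓ) (σ : Fin n → Fin ℓ) : Bool → Bool → (Fin n → Fin ℓ) → Prop
  /-- In the first phase, the larger class attracts the smaller one, and then returns home if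
  too many of its vertices are foreign. -/
  | home (s : Fin ℓ) : IsHome src (mergeLab lab a b) b t s →
      Fits M k (moveClass (mergeLab lab a b) (moveClass lab σ a t) b s) →
      Joins M N k src lab a b t σ true true
        (moveClass (mergeLab lab a b) (moveClass lab σ a t) b s)
  /-- In the second phase, the larger class attracts the smaller one. -/
  | attract (p : Bool) : (p = true → ∃ s, IsHome src (mergeLab lab a b) b t s ∧
        ¬ Fits M k (moveClass (mergeLab lab a b) (moveClass lab σ a t) b s)) →
      Fits M k (moveClass lab σ a t) →
      Joins M N k src lab a b t σ p false (moveClass lab σ a t)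
  /-- If this overloads a server, an improvement is searched. -/
  | repack (p : Bool) (σ' : Fin n → Fin ℓ) : (p = true → ∃ s, IsHome src (mergeLab lab a b) b t s ∧
        ¬ Fits M k (moveClass (mergeLab lab a b) (moveClass lab σ a t) b s)) →
      ¬ Fits M k (moveClass lab σ a t) →
      (Reach M k (mergeLab lab a b) N (moveClass lab σ a t) σ' ∧
          Improves M k t (moveClass lab σ a t) σ' ∨
        σ' = moveClass lab σ a t ∧ ∀ σ'', Reach M k (mergeLab lab a b) N (moveClass lab σ a t) σ'' →
          ¬ Improves M k t (moveClass lab σ a t) σ'') →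
      Joins M N k src lab a b t σ p false σ'

theorem countP_ofFn {α : Type} (f : Fin n → α) (p : α → Bool) :
    (List.ofFn f).countP p = (Finset.univ.filter fun v => p (f v) = true).card := by
  rw [List.ofFn_eq_map, List.countP_map, List.countP_eq_length_filter]
  rw [← List.toFinset_card_of_nodup ((List.nodup_finRange n).filter _)]
  congr 1
  ext v
  simp

variable {src : Fin n → Fin ℓ} {lab : Fin n → Fin n} {σ : Fin n → Fin ℓ}

theorem sizeL_record (a : Fin n) : sizeL (record src lab σ) a = classSize lab a := by
  simp [sizeL, record, countP_ofFn, classSize, Fin.ext_iff]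

theorem loadL_record (s : Fin ℓ) : loadL (record src lab σ) s = load σ s := by
  simp [loadL, record, countP_ofFn, load, Fin.ext_iff]

theorem foreignL_record (a : Fin n) (s : Fin ℓ) :
    foreignL (record src lab σ) a s = foreign src lab a s := by
  simp [foreignL, record, countP_ofFn, foreign, Fin.ext_iff]

theorem mergeL_record (a b : Fin n) (t : Fin ℓ) :
    mergeL (record src lab σ) a b t = record src (mergeLab lab a b) (moveClass lab σ a t) := by
  simp only [mergeL, record, List.map_ofFn, mergeLab, moveClass]
  congr 1
  funext v
  simp only [Function.comp, Fin.ext_iff]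
  split_ifs <;> rfl

theorem moveL_record (b : Fin n) (s : Fin ℓ) :
    moveL (record src lab σ) b s = record src lab (moveClass lab σ b s) := by
  simp only [moveL, record, List.map_ofFn, moveClass]
  congr 1
  funext v
  simp only [Function.comp, Fin.ext_iff]
  split_ifs <;> rfl

theorem shiftL_record {M k : ℕ} (a j : ℕ) (s s' : Fin ℓ) :
    shiftL M k (record src lab σ) (a, j, s, s') = record src lab (shift M k lab σ a j s s') := by
  have h : ∀ v, sizeL (record src lab σ) (lab v) = classSize lab (lab v) :=
    fun v => sizeL_record _
  unfold shiftL
  conv_lhs => arg 2; unfold record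
  rw [List.map_ofFn]
  unfold record at h ⊢
  congr 1
  funext v
  simp only [Function.comp, h, shift, Fin.ext_iff]
  split_ifs <;> rfl

theorem homeL_record (b : Fin n) (t : Fin ℓ) :
    ∃ s : Fin ℓ, homeL ℓ (record src lab σ) b t = s ∧ IsHome src lab b t s := by
  unfold homeL IsHome
  rcases headD_filter (List.range ℓ) (fun s => decide (2 * foreignL (record src lab σ) b s <
    foreignL (record src lab σ) b t)) t with h | h
  · have := h.2
    refine ⟨⟨_, List.mem_range.1 h.1⟩, rfl, .inl ?_⟩
    simpa only [← foreignL_record (σ := σ), decide_eq_true_eq] using this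
  · refine ⟨t, h.1, .inr ⟨rfl, fun s' => ?_⟩⟩
    simpa [← foreignL_record (σ := σ)] using h.2 s' (List.mem_range.2 s'.2)

theorem fitsL_record {M k : ℕ} : fitsL M k ℓ (record src lab σ) = true ↔ Fits M k σ := by
  simp only [fitsL, List.all_eq_true, List.mem_range, decide_eq_true_eq, Fits, ← loadL_record
    (src := src) (lab := lab)]
  exact ⟨fun h s => h s s.2, fun h s hs => h ⟨s, hs⟩⟩

theorem improvesL_record {M k : ℕ} {t : Fin ℓ} {σ' : Fin n → Fin ℓ} :
    improvesL M k ℓ t (record src lab σ) (record src lab σ') = true ↔ Improves M k t σ σ' := by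
  simp only [improvesL, List.all_eq_true, List.mem_range, decide_eq_true_eq, Improves,
    ← loadL_record (src := src) (lab := lab), Fin.ext_iff]
  exact ⟨fun h s => h s s.2, fun h s hs => h ⟨s, hs⟩⟩

theorem candidatesL_record {M k N : ℕ} {L : List Rec} :
    L ∈ candidatesL M k ℓ (record src lab σ) N ↔
      ∃ σ', Reach M k lab N σ σ' ∧ L = record src lab σ' := by
  induction N generalizing L with
  | zero => simp [candidatesL, Reach]
  | succ N ih =>
    simp only [candidatesL, List.mem_flatMap, ih, List.mem_map, paramsL, List.mem_range, Reach]
    constructor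
    · rintro ⟨_, ⟨σ₁, h, rfl⟩, q, ⟨a, ha, j, hj, s, hs, s', hs', rfl⟩, rfl⟩
      simp only [record, List.length_ofFn] at ha hj
      exact ⟨_, ⟨σ₁, h, a, j, by omega, by omega, ⟨s, hs⟩, ⟨s', hs'⟩, rfl⟩,
        shiftL_record a j ⟨s, hs⟩ ⟨s', hs'⟩⟩
    · rintro ⟨_, ⟨σ₁, h, a, j, ha, hj, s, s', rfl⟩, rfl⟩
      refine ⟨_, ⟨σ₁, h, rfl⟩, _, ⟨a, ?_, j, ?_, s, s.2, s', s'.2, rfl⟩, shiftL_record a j s s'⟩ <;>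
      · simp only [record, List.length_ofFn]
        omega

theorem joinL_record (M N k : ℕ) (p : Bool) (a b : Fin n) (t : Fin ℓ) :
    ∃ p' σ', joinL M N k ℓ p (record src lab σ) a b t = (p', record src (mergeLab lab a b) σ') ∧
      Joins M N k src lab a b t σ p p' σ' := by
  unfold joinL
  rw [mergeL_record]
  obtain ⟨s, hs, home⟩ := homeL_record (src := src) (lab := mergeLab lab a b)
    (σ := moveClass lab σ a t) b t
  rw [hs, moveL_record]
  simp only [Bool.cond_eq_ite]
  split_ifs with h₁ h₂
  · obtain ⟨rfl, h₁⟩ := Bool.and_eq_true_iff.1 h₁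
    exact ⟨_, _, rfl, .home s home (fitsL_record.1 h₁)⟩
  all_goals
    have h₁ : p = true → ∃ s, IsHome src (mergeLab lab a b) b t s ∧
        ¬ Fits M k (moveClass (mergeLab lab a b) (moveClass lab σ a t) b s) :=
      fun hp => ⟨s, home, fun h => h₁ (Bool.and_eq_true_iff.2 ⟨hp, fitsL_record.2 h⟩)⟩
    rw [fitsL_record] at h₂
  · exact ⟨_, _, rfl, .attract p h₁ h₂⟩
  unfold repackL
  rcases headD_filter (candidatesL M k ℓ (record src (mergeLab lab a b) (moveClass lab σ a t)) N)
      (improvesL M k ℓ t (record src (mergeLab lab a b) (moveClass lab σ a t)))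
      (record src (mergeLab lab a b) (moveClass lab σ a t)) with h | h
  · obtain ⟨σ', hr, hσ'⟩ := candidatesL_record.1 h.1
    have := h.2
    rw [hσ', improvesL_record] at this
    exact ⟨_, σ', by rw [hσ'], .repack p σ' h₁ h₂ (.inl ⟨hr, this⟩)⟩
  · refine ⟨_, _, by rw [h.1], .repack p _ h₁ h₂ (.inr ⟨rfl, fun σ'' hr hi => ?_⟩)⟩
    have := h.2 _ (candidatesL_record.2 ⟨σ'', hr, rfl⟩)
    rw [improvesL_record.2 hi] at this
    exact absurd this (by simp)

theorem lookup_record (u : Fin n) :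
    lookup (record src lab σ) u = ((src u).val, (lab u).val, (σ u).val) := by
  simp [lookup, record, List.getD_eq_getElem?_getD]

/-- `Steps M N k src e p lab σ p' lab' σ'`: the edge `e` may change the phase, the labels and the
assignment `p`, `lab`, `σ` to `p'`, `lab'`, `σ'`. If it joins two classes, the one with fewer
vertices is `a`, and the vertex of the other one is `w`. -/
inductive Steps (M N k : ℕ) (src : Fin n → Fin ℓ) (e : Fin n × Fin n) (p : Bool)
    (lab : Fin n → Fin n) (σ : Fin n → Fin ℓ) :
    Bool → (Fin n → Fin n) → (Fin n → Fin ℓ) → Prop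
  | skip : lab e.1 = lab e.2 → Steps M N k src e p lab σ p lab σ
  | join (v w : Fin n) (p' : Bool) (σ' : Fin n → Fin ℓ) : (v, w) = e ∨ (w, v) = e →
      lab v ≠ lab w → classSize lab (lab v) ≤ classSize lab (lab w) →
      Joins M N k src lab (lab v) (lab w) (σ w) σ p p' σ' →
      Steps M N k src e p lab σ p' (mergeLab lab (lab v) (lab w)) σ'

theorem stepL_record (M N k : ℕ) (p : Bool) (e : Fin n × Fin n) :
    ∃ p' lab' σ', stepL M N k ℓ (p, record src lab σ) (e.1, e.2) = (p', record src lab' σ') ∧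
      Steps M N k src e p lab σ p' lab' σ' := by
  unfold stepL
  simp only [lookup_record, sizeL_record, Fin.val_inj]
  split_ifs with h₁ h₂
  · exact ⟨_, _, _, rfl, .skip h₁⟩
  · obtain ⟨p', σ', h, hj⟩ := joinL_record M N k p (lab e.1) (lab e.2) (σ e.2) (src := src)
      (lab := lab) (σ := σ)
    exact ⟨p', _, σ', h, .join _ _ p' σ' (.inl rfl) h₁ h₂ hj⟩
  · obtain ⟨p', σ', h, hj⟩ := joinL_record M N k p (lab e.2) (lab e.1) (σ e.1) (src := src)
      (lab := lab) (σ := σ)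
    exact ⟨p', _, σ', h, .join _ _ p' σ' (.inr rfl) (Ne.symm h₁) (not_le.1 h₂).le hj⟩

theorem initL_record : initL (List.ofFn fun v => (src v).val) = record src id src := by
  refine List.ext_getElem (by simp [initL, record]) fun i h₁ h₂ => ?_
  have : i < n := by simpa [record] using h₂
  simp [initL, record, this]

end OnlinePacking

/-! ### Merging classes -/

namespace OnlinePacking

open GraphPartitioning

variable {n ℓ : ℕ}

/-- Every label is a vertex of its class. -/
def IsLabelling (lab : Fin n → Fin n) : Prop := ∀ v, lab (lab v) = lab v

/-- The assignment `σ` keeps the classes together. -/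
def Compatible (lab : Fin n → Fin n) (σ : Fin n → Fin ℓ) : Prop := ∀ v, σ (lab v) = σ v

/-- Number of vertices that are on different servers in `σ` and `τ`. -/
def moved (σ τ : Fin n → Fin ℓ) : ℕ := (Finset.univ.filter fun v => σ v ≠ τ v).card

/-- The least number of vertices of the class `a` that are foreign on some server. -/
noncomputable def minForeign (src : Fin n → Fin ℓ) (lab : Fin n → Fin n) (a : Fin n) : ℕ :=
  ⨅ s, foreign src lab a s

variable {src σ τ : Fin n → Fin ℓ} {lab : Fin n → Fin n} {a b : Fin n} {t : Fin ℓ}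

theorem moved_comm : moved σ τ = moved τ σ := by
  unfold moved
  congr 1
  ext v
  simp [eq_comm]

theorem moved_triangle (σ τ υ : Fin n → Fin ℓ) : moved σ υ ≤ moved σ τ + moved τ υ := by
  unfold moved
  refine (Finset.card_le_card fun v hv => ?_).trans (Finset.card_union_le _ _)
  simp only [Finset.mem_filter, Finset.mem_univ, true_and, Finset.mem_union] at *
  by_contra! h
  exact hv (h.1.trans h.2)

theorem card_filter_eq_sum (lab : Fin n → Fin n) (p : Fin n → Prop) [DecidablePred p] :
    (Finset.univ.filter p).card =
      ∑ a, (Finset.univ.filter fun v => lab v = a ∧ p v).card := by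
  rw [Finset.card_eq_sum_card_fiberwise (f := lab) (t := Finset.univ) (by simp)]
  refine Finset.sum_congr rfl fun a _ => ?_
  rw [Finset.filter_filter]
  congr 1
  ext v
  simp [and_comm]

theorem sum_classSize (lab : Fin n → Fin n) : ∑ a, classSize lab a = n := by
  simpa [classSize] using (card_filter_eq_sum lab fun _ => True).symm

theorem classSize_pos (h : lab a = a) : 1 ≤ classSize lab a :=
  Finset.card_pos.2 ⟨a, by simp [h]⟩

theorem foreign_le_classSize (s : Fin ℓ) : foreign src lab a s ≤ classSize lab a :=
  Finset.card_le_card fun v => by simp +contextual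

/-- A vertex is foreign on all servers but one. -/
theorem classSize_le_foreign_add {s s' : Fin ℓ} (h : s ≠ s') :
    classSize lab a ≤ foreign src lab a s + foreign src lab a s' := by
  refine (Finset.card_le_card fun v hv => ?_).trans (Finset.card_union_le _ _)
  simp only [Finset.mem_filter, Finset.mem_univ, true_and, Finset.mem_union] at *
  by_contra! h'
  exact h ((h'.1 hv).symm.trans (h'.2 hv))

theorem minForeign_le (s : Fin ℓ) : minForeign src lab a ≤ foreign src lab a s :=
  ciInf_le' _ s

theorem exists_minForeign [Nonempty (Fin ℓ)] :
    ∃ s, minForeign src lab a = foreign src lab a s :=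
  (exists_eq_ciInf_of_finite (f := foreign src lab a)).imp fun _ h => h.symm

theorem moved_eq_sum (h : Compatible lab σ) : moved src σ = ∑ a, foreign src lab a (σ a) := by
  unfold moved
  rw [card_filter_eq_sum lab]
  refine Finset.sum_congr rfl fun a _ => congrArg _ (Finset.filter_congr fun v _ => ?_)
  constructor <;> rintro ⟨rfl, h'⟩ <;> simpa [h v] using h'

/-- Any assignment that keeps the classes together moves at least the minimum number of foreign
vertices of every class. -/
theorem sum_minForeign_le (h : Compatible lab τ) :
    ∑ a, minForeign src lab a ≤ moved src τ := by
  rw [moved_eq_sum h]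
  exact Finset.sum_le_sum fun a _ => minForeign_le _

theorem classSize_le_load (h : Compatible lab τ) (a : Fin n) :
    classSize lab a ≤ load τ (τ a) := by
  refine Finset.card_le_card fun v hv => ?_
  simp only [Finset.mem_filter, Finset.mem_univ, true_and] at *
  rw [← h v, hv]

theorem sum_load (σ : Fin n → Fin ℓ) : ∑ s, load σ s = n := by
  have := Finset.card_eq_sum_card_fiberwise (f := σ) (s := Finset.univ) (t := Finset.univ)
    (by simp)
  simpa [load] using this.symm

theorem load_le_add_moved (σ τ : Fin n → Fin ℓ) (s : Fin ℓ) : load τ s ≤ load σ s + moved σ τ := by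
  refine (Finset.card_le_card fun v hv => ?_).trans (Finset.card_union_le _ _)
  simp only [Finset.mem_filter, Finset.mem_univ, true_and, Finset.mem_union] at *
  by_contra! h
  exact h.1 (h.2.trans hv)

theorem moved_moveClass_le : moved σ (moveClass lab σ a t) ≤ classSize lab a := by
  refine Finset.card_le_card fun v hv => ?_
  simp only [Finset.mem_filter, Finset.mem_univ, true_and, moveClass] at *
  by_contra h
  simp [h] at hv

theorem load_moveClass_of_ne {s : Fin ℓ} (h : s ≠ t) :
    load (moveClass lab σ a t) s ≤ load σ s := by
  refine Finset.card_le_card fun v hv => ?_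
  simp only [Finset.mem_filter, Finset.mem_univ, true_and] at *
  unfold moveClass at hv
  split_ifs at hv with h'
  · exact absurd hv.symm h
  · exact hv

theorem load_moveClass_le (s : Fin ℓ) :
    load (moveClass lab σ a t) s ≤ load σ s + classSize lab a :=
  (load_le_add_moved σ _ s).trans (Nat.add_le_add_left moved_moveClass_le _)

theorem IsLabelling.merge (h : IsLabelling lab) (hb : lab b = b) (hab : a ≠ b) :
    IsLabelling (mergeLab lab a b) := by
  intro v
  unfold mergeLab
  by_cases h₁ : lab v = a
  · simp [h₁, hb, hab.symm]
  · simp [h₁, h v]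

theorem Compatible.merge (h : Compatible lab τ) (hτ : τ a = τ b) :
    Compatible (mergeLab lab a b) τ := by
  intro v
  unfold mergeLab
  split_ifs with h₁
  · rw [← hτ, ← h₁, h v]
  · exact h v

theorem Compatible.attract (h : Compatible lab σ) (hl : IsLabelling lab) (hb : lab b = b)
    (hab : a ≠ b) : Compatible (mergeLab lab a b) (moveClass lab σ a (σ b)) := by
  intro v
  unfold mergeLab moveClass
  by_cases h₁ : lab v = a
  · simp [h₁, hb, hab.symm]
  · simp [h₁, hl v, h v]

theorem Compatible.moveClass (h : Compatible lab σ) (hl : IsLabelling lab) :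
    Compatible lab (moveClass lab σ a t) := by
  intro v
  unfold OnlinePacking.moveClass
  rw [hl v, h v]

theorem Compatible.shift {M k j c : ℕ} {s s' : Fin ℓ} (h : Compatible lab σ)
    (hl : IsLabelling lab) : Compatible lab (shift M k lab σ c j s s') := by
  intro v
  unfold OnlinePacking.shift
  rw [hl v, h v]

theorem Compatible.reach {M k N : ℕ} (h : Compatible lab σ) (hl : IsLabelling lab)
    (hr : Reach M k lab N σ τ) : Compatible lab τ := by
  induction N generalizing τ with
  | zero => rwa [hr]
  | succ N ih =>
    obtain ⟨σ₁, h₁, c, j, -, -, s, s', rfl⟩ := hr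
    exact (ih h₁).shift hl

theorem card_mergeLab (hab : a ≠ b) (p : Fin n → Prop) [DecidablePred p] :
    (Finset.univ.filter fun v => mergeLab lab a b v = b ∧ p v).card =
      (Finset.univ.filter fun v => lab v = a ∧ p v).card +
        (Finset.univ.filter fun v => lab v = b ∧ p v).card := by
  rw [← Finset.card_union_of_disjoint]
  · congr 1
    ext v
    simp only [Finset.mem_filter, Finset.mem_univ, true_and, Finset.mem_union]
    unfold mergeLab
    split_ifs with h <;> simp [h, hab]
  · rw [Finset.disjoint_left]
    intro v
    simp only [Finset.mem_filter, Finset.mem_univ, true_and]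
    rintro ⟨rfl, _⟩ ⟨h, _⟩
    exact hab h

theorem foreign_merge (hab : a ≠ b) (s : Fin ℓ) :
    foreign src (mergeLab lab a b) b s = foreign src lab a s + foreign src lab b s :=
  card_mergeLab hab _

theorem classSize_merge (hab : a ≠ b) :
    classSize (mergeLab lab a b) b = classSize lab a + classSize lab b := by
  simpa [classSize] using card_mergeLab (lab := lab) hab fun _ => True

theorem mergeLab_ne (hab : a ≠ b) (v : Fin n) : mergeLab lab a b v ≠ a := by
  unfold mergeLab
  split_ifs with h
  exacts [hab.symm, h]

theorem classSize_merge_self (hab : a ≠ b) : classSize (mergeLab lab a b) a = 0 := by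
  simp [classSize, mergeLab_ne hab]

theorem foreign_merge_self (hab : a ≠ b) (s : Fin ℓ) :
    foreign src (mergeLab lab a b) a s = 0 := by
  simp [foreign, mergeLab_ne hab]

theorem mergeLab_eq_iff {x v : Fin n} (hxa : x ≠ a) (hxb : x ≠ b) :
    mergeLab lab a b v = x ↔ lab v = x := by
  unfold mergeLab
  split_ifs with h
  · simp [h, hxb.symm, hxa.symm]
  · rfl

theorem classSize_merge_of_ne {x : Fin n} (hxa : x ≠ a) (hxb : x ≠ b) :
    classSize (mergeLab lab a b) x = classSize lab x := by
  simp only [classSize, mergeLab_eq_iff hxa hxb]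

theorem foreign_merge_of_ne {x : Fin n} (hxa : x ≠ a) (hxb : x ≠ b) (s : Fin ℓ) :
    foreign src (mergeLab lab a b) x s = foreign src lab x s := by
  simp only [foreign, mergeLab_eq_iff hxa hxb]

theorem sum_merge {F F' : Fin n → ℝ} (hab : a ≠ b) (ha : F' a = 0)
    (h : ∀ x, x ≠ a → x ≠ b → F' x = F x) : ∑ x, F' x + F a + F b = ∑ x, F x + F' b := by
  have key : ∀ G : Fin n → ℝ, ∑ x, G x = ∑ x ∈ (Finset.univ.erase a).erase b, G x + G b + G a := by
    intro G
    rw [← Finset.sum_erase_add _ _ (Finset.mem_univ a),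
      ← Finset.sum_erase_add _ _ (Finset.mem_erase.2 ⟨hab.symm, Finset.mem_univ b⟩)]
  rw [key F, key F', Finset.sum_congr rfl fun x hx => ?_, ha]
  · ring
  · simp only [Finset.mem_erase, Finset.mem_univ, and_true] at hx
    exact h x hx.2 hx.1

/-! ### The first phase -/

/-- The cost of the first phase is charged to this quantity: a foreign vertex pays for every
doubling of its class. -/
noncomputable def minorityPotential (src : Fin n → Fin ℓ) (lab : Fin n → Fin n) : ℝ :=
  ∑ a, (minForeign src lab a : ℝ) * (1 + Real.log (classSize lab a))

theorem half_le_log_add_sub {A B : ℝ} (hA : 1 ≤ A) (hAB : A ≤ B) :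
    1 / 2 ≤ Real.log (A + B) - Real.log A := by
  rw [← Real.log_div (by linarith) (by linarith)]
  have h₁ : 2 ≤ (A + B) / A := by rw [le_div_iff₀ (by linarith)]; linarith
  have h₂ := Real.log_le_log (by norm_num) h₁
  have := Real.log_two_gt_d9
  linarith

theorem half_div_le_log_add_sub {A B : ℝ} (hA : 1 ≤ A) (hAB : A ≤ B) :
    A / B / 2 ≤ Real.log (A + B) - Real.log B := by
  have hB : 0 < B := by linarith
  rw [← Real.log_div (by linarith) (by linarith)]
  have h₁ : 0 < (A + B) / B := by positivity
  have h₂ := Real.one_sub_inv_le_log_of_pos h₁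
  have h₃ : A / B / 2 ≤ 1 - ((A + B) / B)⁻¹ := by
    rw [inv_div, div_div, one_sub_div (by linarith), div_le_div_iff₀ (by linarith) (by linarith)]
    nlinarith
  linarith

/-- The growth of the potential when a class of `A` vertices is merged into a class of `B` vertices
and the minimum numbers of foreign vertices change from `x` and `y` to `z`. -/
theorem minority_gain {A B x y z : ℝ} (hA : 1 ≤ A) (hAB : A ≤ B) (hx : 0 ≤ x) (hy : 0 ≤ y)
    (hz : x + y ≤ z) :
    (z - y + y * (A / B)) / 2 ≤
      z * (1 + Real.log (A + B)) - x * (1 + Real.log A) - y * (1 + Real.log B) := by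
  have h₁ := mul_le_mul_of_nonneg_left (half_le_log_add_sub hA hAB) hx
  have h₂ := mul_le_mul_of_nonneg_left (half_div_le_log_add_sub hA hAB) hy
  have h₃ := mul_nonneg (sub_nonneg.2 hz) (Real.log_nonneg (show 1 ≤ A + B by linarith))
  nlinarith

/-- If the smaller class is attracted from another server, then a fixed fraction of its vertices is
paid for by the growth of the classes of foreign vertices. -/
theorem quarter_le_minority {s t : Fin ℓ} (hst : s ≠ t) (hab : a ≠ b)
    (hs : foreign src lab a s ≤ 2 * minForeign src lab a)
    (ht : foreign src lab b t ≤ 2 * minForeign src lab b)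
    (hA : 1 ≤ classSize lab a) (hAB : classSize lab a ≤ classSize lab b) :
    (classSize lab a : ℝ) / 4 ≤ minForeign src (mergeLab lab a b) b - minForeign src lab b +
      minForeign src lab b * ((classSize lab a : ℝ) / classSize lab b) := by
  have : Nonempty (Fin ℓ) := ⟨s⟩
  obtain ⟨p, hp⟩ := exists_minForeign (src := src) (lab := mergeLab lab a b) (a := b)
  rw [foreign_merge hab] at hp
  have h₁ := minForeign_le (src := src) (lab := lab) (a := a) p
  have h₂ := minForeign_le (src := src) (lab := lab) (a := b) p
  have hA' : (1 : ℝ) ≤ classSize lab a := by exact_mod_cast hA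
  have hAB' : (classSize lab a : ℝ) ≤ classSize lab b := by exact_mod_cast hAB
  rw [hp]
  push_cast
  have h₂' : (minForeign src lab b : ℝ) ≤ foreign src lab b p := by exact_mod_cast h₂
  by_cases h : classSize lab a ≤ 4 * foreign src lab a p
  · have h' : (classSize lab a : ℝ) ≤ 4 * foreign src lab a p := by exact_mod_cast h
    have : 0 ≤ (minForeign src lab b : ℝ) * ((classSize lab a : ℝ) / classSize lab b) := by
      positivity
    linarith
  · -- the smaller class is at home on `p`, and so the larger one is not
    have hsp : s = p := by
      by_contra hne
      have := classSize_le_foreign_add (src := src) (lab := lab) (a := a) hne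
      omega
    have htp : t ≠ p := fun h => hst (hsp.trans h.symm)
    have h₃ := classSize_le_foreign_add (src := src) (lab := lab) (a := b) htp
    have h₄ : classSize lab b ≤ 3 * foreign src lab b p := by omega
    have h₄' : (classSize lab b : ℝ) ≤ 3 * foreign src lab b p := by exact_mod_cast h₄
    have hB : (0 : ℝ) < classSize lab b := by linarith
    set q : ℝ := (classSize lab a : ℝ) / classSize lab b with hq
    have hq₁ : q ≤ 1 := by rw [hq, div_le_one hB]; exact hAB'
    have hq₀ : 0 ≤ q := by positivity
    have hqB : (classSize lab a : ℝ) = q * classSize lab b := by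
      rw [hq, div_mul_cancel₀ _ hB.ne']
    have h₅ : (0 : ℝ) ≤ foreign src lab a p := by positivity
    nlinarith

theorem minForeign_merge_le (s : Fin ℓ) (hab : a ≠ b) :
    minForeign src lab a + minForeign src lab b ≤ minForeign src (mergeLab lab a b) b := by
  have : Nonempty (Fin ℓ) := ⟨s⟩
  obtain ⟨p, hp⟩ := exists_minForeign (src := src) (lab := mergeLab lab a b) (a := b)
  rw [hp, foreign_merge hab]
  exact Nat.add_le_add (minForeign_le p) (minForeign_le p)

theorem minForeign_merge_self (s : Fin ℓ) (hab : a ≠ b) :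
    minForeign src (mergeLab lab a b) a = 0 :=
  Nat.le_zero.1 ((minForeign_le s).trans (foreign_merge_self hab s).le)

theorem minForeign_merge_of_ne {x : Fin n} (hxa : x ≠ a) (hxb : x ≠ b) :
    minForeign src (mergeLab lab a b) x = minForeign src lab x := by
  unfold minForeign
  simp only [foreign_merge_of_ne hxa hxb]

/-- In the first phase, the growth of the potential pays for the attraction of the smaller class,
and for the vertices that this takes away from their sources. -/
theorem attract_cost_le (hσ : Compatible lab σ)
    (hmin : ∀ x, foreign src lab x (σ x) ≤ 2 * minForeign src lab x) (ha : lab a = a)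
    (hab : a ≠ b) (hAB : classSize lab a ≤ classSize lab b) :
    (moved σ (moveClass lab σ a (σ b)) : ℝ) + 4 * moved src (moveClass lab σ a (σ b)) ≤
      4 * moved src σ +
        40 * (minorityPotential src (mergeLab lab a b) - minorityPotential src lab) := by
  have hsum := sum_merge (a := a) (b := b)
    (F := fun x => (minForeign src lab x : ℝ) * (1 + Real.log (classSize lab x)))
    (F' := fun x => (minForeign src (mergeLab lab a b) x : ℝ) *
      (1 + Real.log (classSize (mergeLab lab a b) x))) hab
    (by simp [minForeign_merge_self (σ b) hab])
    (fun x hxa hxb => by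
      simp only [minForeign_merge_of_ne hxa hxb, classSize_merge_of_ne hxa hxb])
  have hA : (1 : ℝ) ≤ classSize lab a := by exact_mod_cast classSize_pos ha
  have hAB' : (classSize lab a : ℝ) ≤ classSize lab b := by exact_mod_cast hAB
  have hz : (minForeign src lab a : ℝ) + minForeign src lab b ≤
      minForeign src (mergeLab lab a b) b := by exact_mod_cast minForeign_merge_le (σ b) hab
  have hgain := minority_gain hA hAB' (Nat.cast_nonneg _) (Nat.cast_nonneg _) hz
  simp only [classSize_merge hab, Nat.cast_add] at hsum
  unfold minorityPotential
  by_cases hst : σ a = σ b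
  · have : moveClass lab σ a (σ b) = σ := by
      funext v
      unfold moveClass
      split_ifs with h
      · rw [← hst, ← h, hσ v]
      · rfl
    rw [this]
    have h₁ : (moved σ σ : ℝ) = 0 := by simp [moved]
    have h₂ : 0 ≤ (minForeign src lab b : ℝ) * ((classSize lab a : ℝ) / classSize lab b) := by
      positivity
    have h₃ : (0 : ℝ) ≤ minForeign src lab a := by positivity
    linarith
  · have hq := quarter_le_minority hst hab (hmin a) (hmin b) (classSize_pos ha) hAB
    have h₁ : (moved σ (moveClass lab σ a (σ b)) : ℝ) ≤ classSize lab a := by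
      exact_mod_cast moved_moveClass_le (lab := lab) (σ := σ) (a := a) (t := σ b)
    have h₂ : (moved src (moveClass lab σ a (σ b)) : ℝ) ≤
        moved src σ + moved σ (moveClass lab σ a (σ b)) := by
      exact_mod_cast moved_triangle _ _ _
    linarith

theorem moved_add_foreign (s : Fin ℓ) (hσ : Compatible lab σ) (hb : lab b = b)
    (hl : IsLabelling lab) :
    moved src (moveClass lab σ b s) + foreign src lab b (σ b) =
      moved src σ + foreign src lab b s := by
  rw [moved_eq_sum hσ, moved_eq_sum (hσ.moveClass hl), ← Finset.sum_erase_add _ _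
    (Finset.mem_univ b), ← Finset.sum_erase_add _ (fun a => foreign src lab a (σ a))
    (Finset.mem_univ b), Finset.sum_congr rfl (g := fun a => foreign src lab a (σ a)) fun x hx => ?_]
  · simp only [moveClass, hb, if_true]
    ring
  · have hxb := Finset.ne_of_mem_erase hx
    by_cases h : lab x = b
    · have : ∀ v, lab v ≠ x := by
        rintro v rfl
        exact hxb (by rw [← h, hl v])
      simp [foreign, this]
    · simp [moveClass, h]

/-- Returning home is paid for by the decrease of the number of vertices away from their source. -/
theorem home_cost_le {s : Fin ℓ} (hσ : Compatible lab σ) (hb : lab b = b) (hl : IsLabelling lab)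
    (hs : IsHome src lab b (σ b) s) :
    moved σ (moveClass lab σ b s) + 4 * moved src (moveClass lab σ b s) ≤ 4 * moved src σ := by
  have h₁ := moved_add_foreign (src := src) s hσ hb hl
  rcases hs with hs | ⟨rfl, -⟩
  · have hne : s ≠ σ b := by
      rintro rfl
      omega
    have h₂ := classSize_le_foreign_add (src := src) (lab := lab) (a := b) hne
    have h₃ := moved_moveClass_le (lab := lab) (σ := σ) (a := b) (t := s)
    omega
  · have : moveClass lab σ b (σ b) = σ := by
      funext v
      unfold moveClass
      split_ifs with h
      · rw [← h, hσ v]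
      · rfl
    rw [this] at h₁ ⊢
    have : moved σ σ = 0 := by simp [moved]
    omega

/-- If fewer than half as many vertices are foreign on `s` as on `t`, then `s` is the source of more
than half of the class, and so no server has fewer foreign vertices. -/
theorem IsHome.foreign_le {s : Fin ℓ} (hs : IsHome src lab b t s) :
    foreign src lab b s ≤ 2 * minForeign src lab b := by
  have : Nonempty (Fin ℓ) := ⟨s⟩
  obtain ⟨p, hp⟩ := exists_minForeign (src := src) (lab := lab) (a := b)
  rw [hp]
  rcases hs with hs | ⟨rfl, hs⟩
  · by_cases h : s = p
    · rw [h]; omega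
    · have h₁ := classSize_le_foreign_add (src := src) (lab := lab) (a := b) h
      have h₂ := foreign_le_classSize (src := src) (lab := lab) (a := b) t
      omega
  · have := hs p
    omega

/-- In the first phase, every class has at most twice as many foreign vertices as necessary. -/
theorem foreign_attract_home {s : Fin ℓ} (hab : a ≠ b) (hb : lab b = b)
    (hl : IsLabelling lab)
    (hmin : ∀ x, foreign src lab x (σ x) ≤ 2 * minForeign src lab x)
    (hs : IsHome src (mergeLab lab a b) b (σ b) s) (x : Fin n) :
    foreign src (mergeLab lab a b) x
        (moveClass (mergeLab lab a b) (moveClass lab σ a (σ b)) b s x) ≤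
      2 * minForeign src (mergeLab lab a b) x := by
  by_cases hxa : x = a
  · rw [hxa, foreign_merge_self hab]
    exact Nat.zero_le _
  by_cases hxb : x = b
  · have : moveClass (mergeLab lab a b) (moveClass lab σ a (σ b)) b s b = s := by
      simp [moveClass, mergeLab, hb]
    rw [hxb, this]
    exact hs.foreign_le
  · rw [foreign_merge_of_ne hxa hxb, minForeign_merge_of_ne hxa hxb]
    by_cases hx : lab x = x
    · have : moveClass (mergeLab lab a b) (moveClass lab σ a (σ b)) b s x = σ x := by
        simp [moveClass, mergeLab, hx, hxa, hxb]
      rw [this]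
      exact hmin x
    · have : ∀ v, lab v ≠ x := by
        rintro v rfl
        exact hx (hl v)
      simp [foreign, this]

/-- The potential is at most logarithmic in `k` times the number of vertices that any assignment
moves from their sources in order to keep the classes together. -/
theorem minorityPotential_le {k : ℕ} (hτ : Compatible lab τ) (hk : ∀ a, classSize lab a ≤ k) :
    minorityPotential src lab ≤ moved src τ * (1 + Real.log k) := by
  have h₁ : minorityPotential src lab ≤ ∑ a, (minForeign src lab a : ℝ) * (1 + Real.log k) := by
    refine Finset.sum_le_sum fun a _ => mul_le_mul_of_nonneg_left ?_ (by positivity)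
    rcases Nat.eq_zero_or_pos (classSize lab a) with h | h
    · rw [h, Nat.cast_zero, Real.log_zero]
      have := Real.log_natCast_nonneg k
      linarith
    · have := Real.log_le_log (by exact_mod_cast h) (Nat.cast_le (α := ℝ).2 (hk a))
      linarith
  refine h₁.trans ?_
  rw [← Finset.sum_mul]
  have := Real.log_natCast_nonneg k
  refine mul_le_mul_of_nonneg_right ?_ (by linarith)
  exact_mod_cast sum_minForeign_le hτ

/-! ### The second phase -/

/-- In the second phase, a vertex pays for every doubling of its class. -/
noncomputable def sizePotential (lab : Fin n → Fin n) : ℝ :=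
  ∑ a, (classSize lab a : ℝ) * Real.log (classSize lab a)

/-- The total excess of the servers over the volume `1 + 4 / M`. -/
def excess (M k : ℕ) (σ : Fin n → Fin ℓ) : ℕ := ∑ s, (M * load σ s - (M + 4) * k)

theorem sizePotential_nonneg (lab : Fin n → Fin n) : 0 ≤ sizePotential lab :=
  Finset.sum_nonneg fun _ _ => mul_nonneg (Nat.cast_nonneg _) (Real.log_natCast_nonneg _)

theorem sizePotential_le {k : ℕ} (hk : ∀ a, classSize lab a ≤ k) :
    sizePotential lab ≤ n * Real.log k := by
  have h₁ : sizePotential lab ≤ ∑ a, (classSize lab a : ℝ) * Real.log k := by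
    refine Finset.sum_le_sum fun a _ => mul_le_mul_of_nonneg_left ?_ (by positivity)
    rcases Nat.eq_zero_or_pos (classSize lab a) with h | h
    · rw [h, Nat.cast_zero, Real.log_zero]
      exact Real.log_natCast_nonneg k
    · exact Real.log_le_log (by exact_mod_cast h) (Nat.cast_le (α := ℝ).2 (hk a))
  refine h₁.trans ?_
  rw [← Finset.sum_mul, ← Nat.cast_sum, sum_classSize]

/-- The size of a class at least doubles when it is merged into a larger one, and so the growth of the
potential pays for moving it. -/
theorem classSize_le_sizePotential_sub (ha : lab a = a) (hab : a ≠ b)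
    (hAB : classSize lab a ≤ classSize lab b) :
    (classSize lab a : ℝ) ≤ 2 * (sizePotential (mergeLab lab a b) - sizePotential lab) := by
  have hsum := sum_merge (a := a) (b := b)
    (F := fun x => (classSize lab x : ℝ) * Real.log (classSize lab x))
    (F' := fun x => (classSize (mergeLab lab a b) x : ℝ) *
      Real.log (classSize (mergeLab lab a b) x)) hab
    (by simp [classSize_merge_self hab])
    (fun x hxa hxb => by simp only [classSize_merge_of_ne hxa hxb])
  have hA : (1 : ℝ) ≤ classSize lab a := by exact_mod_cast classSize_pos ha
  have hAB' : (classSize lab a : ℝ) ≤ classSize lab b := by exact_mod_cast hAB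
  simp only [classSize_merge hab, Nat.cast_add] at hsum
  have h₁ := half_le_log_add_sub hA hAB'
  have h₂ : Real.log (classSize lab b) ≤ Real.log (classSize lab a + classSize lab b) :=
    Real.log_le_log (by linarith) (by linarith)
  unfold sizePotential
  nlinarith

theorem excess_le (M k : ℕ) (σ : Fin n → Fin ℓ) : excess M k σ ≤ M * n := by
  refine (Finset.sum_le_sum fun s _ => Nat.sub_le _ _).trans ?_
  rw [← Finset.mul_sum, sum_load]

theorem excess_attract_le (M k : ℕ) (lab : Fin n → Fin n) (σ : Fin n → Fin ℓ) (a : Fin n)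
    (t : Fin ℓ) :
    excess M k (moveClass lab σ a t) ≤ excess M k σ + M * classSize lab a := by
  unfold excess
  rw [← Finset.sum_erase_add _ _ (Finset.mem_univ t),
    ← Finset.sum_erase_add _ (fun s => M * load σ s - (M + 4) * k) (Finset.mem_univ t)]
  have h₁ : ∑ s ∈ Finset.univ.erase t, (M * load (moveClass lab σ a t) s - (M + 4) * k) ≤
      ∑ s ∈ Finset.univ.erase t, (M * load σ s - (M + 4) * k) := by
    refine Finset.sum_le_sum fun s hs => ?_
    have := Nat.mul_le_mul_left M
      (load_moveClass_of_ne (lab := lab) (σ := σ) (a := a) (Finset.ne_of_mem_erase hs))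
    omega
  have h₂ := Nat.mul_le_mul_left M (load_moveClass_le (lab := lab) (σ := σ) (a := a) (t := t) t)
  rw [Nat.mul_add] at h₂
  omega

/-- An improvement removes an overload, and with it an excess that is proportional to `k`. -/
theorem Improves.excess_le {M k : ℕ} {σ' : Fin n → Fin ℓ} (h : Improves M k t σ σ')
    (ht : (M + 8) * k ≤ M * load σ t) : excess M k σ' + 4 * k ≤ excess M k σ := by
  unfold excess
  rw [← Finset.sum_erase_add _ _ (Finset.mem_univ t),
    ← Finset.sum_erase_add _ (fun s => M * load σ s - (M + 4) * k) (Finset.mem_univ t)]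
  have h₁ : ∑ s ∈ Finset.univ.erase t, (M * load σ' s - (M + 4) * k) ≤
      ∑ s ∈ Finset.univ.erase t, (M * load σ s - (M + 4) * k) := by
    refine Finset.sum_le_sum fun s _ => ?_
    rcases h s with h | ⟨-, h⟩
    · omega
    · have := Nat.mul_le_mul_left M h
      omega
  have h₂ : M * load σ' t ≤ (M + 4) * k := by simpa using h t
  have h₃ : (M + 8) * k = (M + 4) * k + 4 * k := by ring
  omega

theorem moved_shift_le {M k j c : ℕ} {s s' : Fin ℓ} (hk : ∀ a, classSize lab a ≤ k) :
    moved σ (shift M k lab σ c j s s') ≤ k + load σ s := by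
  have hc : (Finset.univ.filter fun v => (lab v).val = c).card ≤ k := by
    by_cases h : c < n
    · refine le_trans (Finset.card_le_card fun v hv => ?_) (hk ⟨c, h⟩)
      simpa [Fin.ext_iff] using hv
    · have : ∀ v, (lab v).val ≠ c := fun v => by omega
      simp [this]
  refine (Finset.card_le_card fun v hv => ?_).trans
    ((Finset.card_union_le _ _).trans (Nat.add_le_add_right hc _))
  simp only [Finset.mem_filter, Finset.mem_univ, true_and, Finset.mem_union, shift] at *
  by_contra! h
  simp [h.1, h.2] at hv

/-- An elementary operation at most doubles the maximum load, up to the size of one class; so the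
cost of `N` operations is bounded by a constant multiple of `B`. -/
theorem reach_bounds {M k N B : ℕ} (hk : ∀ a, classSize lab a ≤ k) (hkB : k ≤ B)
    (hB : ∀ s, load σ s ≤ B) (h : Reach M k lab N σ τ) :
    moved σ τ ≤ 3 ^ N * B ∧ ∀ s, load τ s ≤ 3 ^ N * B := by
  induction N generalizing τ with
  | zero =>
    rw [h]
    exact ⟨by simp [moved], by simpa using hB⟩
  | succ N ih =>
    obtain ⟨σ₁, h₁, c, j, -, -, s, s', rfl⟩ := h
    obtain ⟨h₂, h₃⟩ := ih h₁
    have h₄ := moved_shift_le (σ := σ₁) (M := M) (j := j) (c := c) (s := s) (s' := s') hk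
    have h₅ := moved_triangle σ σ₁ (shift M k lab σ₁ c j s s')
    have h₆ := h₃ s
    have h₇ : B ≤ 3 ^ N * B := Nat.le_mul_of_pos_left _ (by positivity)
    have h₈ : 3 ^ (N + 1) * B = 3 * (3 ^ N * B) := by ring
    refine ⟨by omega, fun r => ?_⟩
    have h₉ := load_le_add_moved σ₁ (shift M k lab σ₁ c j s s') r
    have := h₃ r
    omega

end OnlinePacking

/-! ### Exchanging the contents of boundedly many servers -/

namespace OnlinePacking

open GraphPartitioning

theorem sum_card_fiber_mul {ι X : Type} [Fintype X] [DecidableEq X] (G : Finset ι) (f : ι → X)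
    (w : X → ℕ) : ∑ x, (G.filter fun s => f s = x).card * w x = ∑ s ∈ G, w (f s) := by
  rw [← Finset.sum_fiberwise' G f w]
  simp

/-- A family of elements of `X` has a subfamily with prescribed smaller multiplicities, which may be
chosen to contain a given member. -/
theorem exists_subfamily {ℓ : ℕ} {X : Type} [DecidableEq X] (f : Fin ℓ → X) (z : X → ℕ)
    (t : Option (Fin ℓ)) (hz : ∀ x, z x ≤ (Finset.univ.filter fun s => f s = x).card)
    (ht : ∀ s ∈ t, 1 ≤ z (f s)) :
    ∃ G : Finset (Fin ℓ), (∀ s ∈ t, s ∈ G) ∧ ∀ x, (G.filter fun s => f s = x).card = z x := by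
  have key : ∀ x, ∃ u : Finset (Fin ℓ), (Finset.univ.filter fun s => s ∈ t ∧ f s = x) ⊆ u ∧
      u ⊆ (Finset.univ.filter fun s => f s = x) ∧ u.card = z x := by
    intro x
    refine Finset.exists_subsuperset_card_eq ?_ ?_ (hz x)
    · intro s
      simp only [Finset.mem_filter, Finset.mem_univ, true_and]
      exact fun h => h.2
    · cases t with
      | none => simp
      | some t =>
        by_cases h : f t = x
        · refine le_trans (Finset.card_le_one.2 fun s hs s' hs' => ?_) (h ▸ ht t rfl)
          simp only [Finset.mem_filter, Finset.mem_univ, true_and, Option.mem_def,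
            Option.some.injEq] at hs hs'
          rw [← hs.1, ← hs'.1]
        · refine le_trans (le_of_eq ?_) (Nat.zero_le _)
          rw [Finset.card_eq_zero, Finset.filter_eq_empty_iff]
          rintro s - ⟨hs, hx⟩
          rw [Option.mem_def, Option.some.injEq] at hs
          exact h (hs ▸ hx)
  choose u h₁ h₂ h₃ using key
  refine ⟨Finset.univ.filter fun s => s ∈ u (f s), fun s hs => ?_, fun x => ?_⟩
  · simpa using h₁ (f s) (by simpa using hs)
  · rw [← h₃ x]
    congr 1
    ext s
    simp only [Finset.mem_filter, Finset.mem_univ, true_and]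
    constructor
    · rintro ⟨h, rfl⟩
      exact h
    · intro h
      have := h₂ x h
      simp only [Finset.mem_filter, Finset.mem_univ, true_and] at this
      exact ⟨this ▸ h, this⟩

/-- By Dickson's lemma, a property of the multiplicities of two families with members in finite
sets passes to subfamilies of bounded size, one of which contains a given member. -/
theorem exists_bounded_subfamilies (X Y : Type) [Fintype X] [DecidableEq X] [Fintype Y]
    [DecidableEq Y] (P : (X → ℕ) → (Y → ℕ) → Prop) :
    ∃ K : ℕ, ∀ (ℓ : ℕ) (f : Fin ℓ → X) (g : Fin ℓ → Y) (t : Fin ℓ),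
      P (fun x => (Finset.univ.filter fun s => f s = x).card)
        (fun y => (Finset.univ.filter fun s => g s = y).card) →
      ∃ G G' : Finset (Fin ℓ), t ∈ G ∧ G.card ≤ K ∧
        P (fun x => (G.filter fun s => f s = x).card)
          (fun y => (G'.filter fun s => g s = y).card) := by
  let S : X → Set ((X → ℕ) × (Y → ℕ)) := fun x => {z | P z.1 z.2 ∧ 1 ≤ z.1 x}
  have key : ∀ x, ∃ K : ℕ, ∀ z, Minimal (· ∈ S x) z → ∑ x', z.1 x' ≤ K := by
    intro x
    have hfin : {z | Minimal (· ∈ S x) z}.Finite :=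
      WellQuasiOrderedLE.finite_of_isAntichain (setOfPred_minimal_antichain _)
    obtain ⟨K, hK⟩ := (hfin.image fun z => ∑ x', z.1 x').bddAbove
    exact ⟨K, fun z hz => hK ⟨z, hz, rfl⟩⟩
  choose K hK using key
  refine ⟨∑ x, K x, fun ℓ f g t h => ?_⟩
  have ht : 0 < (Finset.univ.filter fun s => f s = f t).card :=
    Finset.card_pos.2 ⟨t, Finset.mem_filter.2 ⟨Finset.mem_univ t, rfl⟩⟩
  obtain ⟨z, hle, hz⟩ := (Set.isPWO_of_wellQuasiOrderedLE (S (f t))).exists_le_minimal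
    (a := (fun x => (Finset.univ.filter fun s => f s = x).card,
      fun y => (Finset.univ.filter fun s => g s = y).card))
    ⟨h, ht⟩
  obtain ⟨G, htG, hG⟩ := exists_subfamily f z.1 (some t) hle.1 (by
    rintro s ⟨⟩
    exact hz.1.2)
  obtain ⟨G', -, hG'⟩ := exists_subfamily g z.2 none hle.2 (by simp)
  refine ⟨G, G', htG t rfl, ?_, ?_⟩
  · rw [Finset.card_eq_sum_card_fiberwise (f := f) (t := Finset.univ) (by simp)]
    simp only [hG]
    exact (hK (f t) z hz).trans (Finset.single_le_sum (f := K) (by simp) (Finset.mem_univ _))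
  · simp only [hG, hG']
    exact hz.1.1

/-- If two finite sets have as many elements of each type, then there is an injection between them
that preserves types. -/
theorem exists_injOn_of_card_fiber_eq {α κ : Type} [DecidableEq κ] (B B' : Finset α) (q : α → κ)
    (h : ∀ i, (B.filter fun a => q a = i).card = (B'.filter fun a => q a = i).card) :
    ∃ β : α → α, (∀ a ∈ B, β a ∈ B' ∧ q (β a) = q a) ∧ Set.InjOn β B := by
  have e : ∀ i, (B.filter fun a => q a = i) ≃ (B'.filter fun a => q a = i) :=
    fun i => Finset.equivOfCardEq (h i)
  classical
  let β : α → α := fun a => if ha : a ∈ B then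
    (e (q a) ⟨a, Finset.mem_filter.2 ⟨ha, rfl⟩⟩ : α) else a
  have hβ : ∀ a (ha : a ∈ B) i (hi : q a = i),
      β a = (e i ⟨a, Finset.mem_filter.2 ⟨ha, hi⟩⟩ : α) := by
    rintro a ha i rfl
    exact dif_pos ha
  have hmem : ∀ a ∈ B, β a ∈ B' ∧ q (β a) = q a := by
    intro a ha
    rw [hβ a ha _ rfl]
    exact Finset.mem_filter.1 (e (q a) ⟨a, Finset.mem_filter.2 ⟨ha, rfl⟩⟩).2
  refine ⟨β, hmem, fun a ha a' ha' heq => ?_⟩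
  have hq : q a' = q a := by rw [← (hmem a ha).2, ← (hmem a' ha').2, heq]
  rw [hβ a ha _ rfl, hβ a' ha' _ hq] at heq
  exact congrArg Subtype.val ((e (q a)).injective (Subtype.ext heq))

variable {n ℓ M k : ℕ} {lab : Fin n → Fin n} {σ τ : Fin n → Fin ℓ}

theorem sum_classSize_eq (lab : Fin n → Fin n) (A : Finset (Fin n)) :
    ∑ a ∈ A, classSize lab a = (Finset.univ.filter fun v => lab v ∈ A).card := by
  rw [Finset.card_eq_sum_card_fiberwise (f := lab) (t := A) (by intro v; simp)]
  refine Finset.sum_congr rfl fun a ha => congrArg Finset.card ?_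
  ext v
  simp only [Finset.mem_filter, Finset.mem_univ, true_and]
  exact ⟨fun h => ⟨h ▸ ha, h⟩, fun h => h.2⟩

theorem sum_classSize_le_load (hσ : Compatible lab σ) {A : Finset (Fin n)} {s : Fin ℓ}
    (hA : ∀ a ∈ A, σ a = s) : ∑ a ∈ A, classSize lab a ≤ load σ s := by
  rw [sum_classSize_eq]
  refine Finset.card_le_card fun v hv => ?_
  simp only [Finset.mem_filter, Finset.mem_univ, true_and] at *
  rw [← hσ v]
  exact hA _ hv

theorem sum_load_eq (σ : Fin n → Fin ℓ) (G : Finset (Fin ℓ)) :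
    ∑ s ∈ G, load σ s = (Finset.univ.filter fun v => σ v ∈ G).card := by
  rw [Finset.card_eq_sum_card_fiberwise (f := σ) (t := G) (by intro v; simp)]
  refine Finset.sum_congr rfl fun a ha => congrArg Finset.card ?_
  ext v
  simp only [Finset.mem_filter, Finset.mem_univ, true_and]
  exact ⟨fun h => ⟨h ▸ ha, h⟩, fun h => h.2⟩

theorem Reach.trans {i j : ℕ} {υ : Fin n → Fin ℓ} (h : Reach M k lab i σ τ)
    (h' : Reach M k lab j τ υ) : Reach M k lab (i + j) σ υ := by
  induction j generalizing υ with
  | zero => rw [h']; exact h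
  | succ j ih =>
    obtain ⟨σ₁, h₁, h₂⟩ := h'
    exact ⟨σ₁, ih h₁, h₂⟩

theorem Reach.mono {i j : ℕ} (t : Fin ℓ) (h : Reach M k lab i σ τ) (hij : i ≤ j) :
    Reach M k lab j σ τ := by
  induction j, hij using Nat.le_induction with
  | base => exact h
  | succ j _ ih =>
    refine ⟨τ, ih, n, 0, le_rfl, Nat.zero_le _, t, t, ?_⟩
    funext v
    have : (lab v).val ≠ n := (lab v).2.ne
    simp [shift, this]

/-- The classes in `B` may be moved one by one. -/
theorem reach_move (ρ : Fin n → Fin ℓ) (B : Finset (Fin n)) :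
    Reach M k lab B.card σ fun v => if lab v ∈ B then ρ (lab v) else σ v := by
  induction B using Finset.induction_on with
  | empty => simp [Reach]
  | insert a B ha ih =>
    rw [Finset.card_insert_of_notMem ha]
    refine ⟨_, ih, a, 0, a.2.le, Nat.zero_le _, ρ a, ρ a, ?_⟩
    funext v
    simp only [shift, Finset.mem_insert, Fin.val_inj, Nat.not_lt_zero, false_and, and_false,
      or_false]
    by_cases h : lab v = a
    · simp [h]
    · simp [h]

/-! ### Sweeping the small classes -/

/-- Number of vertices of big classes on the server `s`. -/
def bigLoad (M k : ℕ) (lab : Fin n → Fin n) (σ : Fin n → Fin ℓ) (s : Fin ℓ) : ℕ :=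
  (Finset.univ.filter fun v => σ v = s ∧ k ≤ M * classSize lab (lab v)).card

/-- The small classes with label below `j` on `s` move to `s'`. -/
def sweep (M k : ℕ) (lab : Fin n → Fin n) (σ : Fin n → Fin ℓ) (s s' : Fin ℓ) (j : ℕ) :
    Fin n → Fin ℓ :=
  shift M k lab σ n j s s'

theorem sweep_apply (s s' : Fin ℓ) (j : ℕ) (v : Fin n) : sweep M k lab σ s s' j v =
    if σ v = s ∧ (lab v).val < j ∧ M * classSize lab (lab v) < k then s' else σ v := by
  have : (lab v).val ≠ n := (lab v).2.ne
  simp [sweep, shift, this]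

theorem sweep_zero (s s' : Fin ℓ) : sweep M k lab σ s s' 0 = σ := by
  funext v
  simp [sweep_apply]

/-- If `j` increases by one, then at most one further small class is swept. -/
theorem mul_moved_sweep_succ_lt (hk : 1 ≤ k) (s s' : Fin ℓ) (j : ℕ) :
    M * moved (sweep M k lab σ s s' j) (sweep M k lab σ s s' (j + 1)) < k := by
  have hdiff : ∀ v, sweep M k lab σ s s' j v ≠ sweep M k lab σ s s' (j + 1) v →
      (lab v).val = j ∧ M * classSize lab (lab v) < k := by
    intro v hv
    by_contra h
    refine hv ?_
    rw [sweep_apply, sweep_apply]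
    congr 1
    rw [eq_iff_iff]
    constructor
    · exact fun h' => ⟨h'.1, by omega, h'.2.2⟩
    · exact fun h' => ⟨h'.1, by have := h'.2; omega, h'.2.2⟩
  unfold moved
  rcases Finset.eq_empty_or_nonempty (Finset.univ.filter fun v =>
    sweep M k lab σ s s' j v ≠ sweep M k lab σ s s' (j + 1) v) with h | ⟨v, hv⟩
  · rw [h, Finset.card_empty, Nat.mul_zero]
    omega
  · simp only [Finset.mem_filter, Finset.mem_univ, true_and] at hv
    obtain ⟨h₁, h₂⟩ := hdiff v hv
    refine lt_of_le_of_lt (Nat.mul_le_mul_left M (Finset.card_le_card fun w hw => ?_)) h₂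
    simp only [Finset.mem_filter, Finset.mem_univ, true_and] at *
    exact Fin.ext ((hdiff w hw).1.trans h₁.symm)

theorem load_sweep_of_ne {s s' r : Fin ℓ} (hs : r ≠ s) (hs' : r ≠ s') (j : ℕ) :
    load (sweep M k lab σ s s' j) r = load σ r := by
  unfold load
  congr 1
  ext v
  simp only [Finset.mem_filter, Finset.mem_univ, true_and, sweep_apply]
  split_ifs with h
  · rw [h.1]
    simp [hs.symm, hs'.symm]
  · rfl

theorem load_sweep_le_bigLoad {s s' : Fin ℓ} (h : s ≠ s') :
    load (sweep M k lab σ s s' n) s ≤ bigLoad M k lab σ s := by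
  refine Finset.card_le_card fun v hv => ?_
  simp only [Finset.mem_filter, Finset.mem_univ, true_and, sweep_apply] at *
  split_ifs at hv with h'
  · exact absurd hv.symm h
  · exact ⟨hv, not_lt.1 fun h'' => h' ⟨hv, (lab v).2, h''⟩⟩

theorem bigLoad_sweep (s s' : Fin ℓ) (j : ℕ) (r : Fin ℓ) :
    bigLoad M k lab (sweep M k lab σ s s' j) r = bigLoad M k lab σ r := by
  unfold bigLoad
  congr 1
  ext v
  simp only [Finset.mem_filter, Finset.mem_univ, true_and, sweep_apply]
  refine and_congr_left fun h => ?_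
  rw [if_neg]
  rintro ⟨-, -, h'⟩
  omega

theorem sum_load_sweep {G : Finset (Fin ℓ)} {s s' : Fin ℓ} (hs : s ∈ G) (hs' : s' ∈ G) (j : ℕ) :
    ∑ r ∈ G, load (sweep M k lab σ s s' j) r = ∑ r ∈ G, load σ r := by
  rw [sum_load_eq, sum_load_eq]
  congr 1
  ext v
  simp only [Finset.mem_filter, Finset.mem_univ, true_and, sweep_apply]
  split_ifs with h
  · rw [h.1]
    simp [hs, hs']
  · rfl

/-- Number of servers in `G` that are overloaded, plus number of those which have much space
left. -/
def imbalance (M k : ℕ) (G : Finset (Fin ℓ)) (σ : Fin n → Fin ℓ) : ℕ :=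
  (G.filter fun s => (M + 4) * k < M * load σ s).card +
    (G.filter fun s => M * load σ s ≤ (M + 3) * k).card

theorem imbalance_le (G : Finset (Fin ℓ)) : imbalance M k G σ ≤ G.card := by
  unfold imbalance
  rw [← Finset.card_union_of_disjoint]
  · exact Finset.card_le_card (Finset.union_subset (Finset.filter_subset _ _)
      (Finset.filter_subset _ _))
  · rw [Finset.disjoint_left]
    intro s h₁ h₂
    simp only [Finset.mem_filter] at h₁ h₂
    have : (M + 3) * k ≤ (M + 4) * k := Nat.mul_le_mul_right _ (by omega)
    omega

/-- One sweep from an overloaded server `s` to a server `s'` with much space left, which is stopped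
as soon as one of them is in order. -/
theorem exists_sweep (hk : 1 ≤ k) {G : Finset (Fin ℓ)} {s s' : Fin ℓ} (hs : s ∈ G) (hs' : s' ∈ G)
    (h : (M + 4) * k < M * load σ s) (h' : M * load σ s' ≤ (M + 3) * k)
    (hbig : M * bigLoad M k lab σ s ≤ (M + 1) * k) :
    ∃ j ≤ n, imbalance M k G (sweep M k lab σ s s' j) < imbalance M k G σ := by
  have e₃ : (M + 3) * k = M * k + 3 * k := by ring
  have e₄ : (M + 4) * k = M * k + 4 * k := by ring
  have e₁ : (M + 1) * k = M * k + k := by ring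
  have hne : s ≠ s' := by
    rintro rfl
    omega
  have hn : M * load (sweep M k lab σ s s' n) s ≤ (M + 4) * k ∨
      (M + 3) * k < M * load (sweep M k lab σ s s' n) s' := by
    left
    have := Nat.mul_le_mul_left M (load_sweep_le_bigLoad (M := M) (k := k) (lab := lab) (σ := σ) hne)
    omega
  have hex : ∃ j, M * load (sweep M k lab σ s s' j) s ≤ (M + 4) * k ∨
      (M + 3) * k < M * load (sweep M k lab σ s s' j) s' := ⟨n, hn⟩
  classical
  obtain ⟨j, hj, hmin⟩ : ∃ j, (M * load (sweep M k lab σ s s' j) s ≤ (M + 4) * k ∨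
      (M + 3) * k < M * load (sweep M k lab σ s s' j) s') ∧
      ∀ i < j, ¬ (M * load (sweep M k lab σ s s' i) s ≤ (M + 4) * k ∨
        (M + 3) * k < M * load (sweep M k lab σ s s' i) s') :=
    ⟨Nat.find hex, Nat.find_spec hex, fun i => Nat.find_min hex⟩
  have hjn : j ≤ n := by
    by_contra hlt
    exact hmin n (by omega) hn
  obtain ⟨i, rfl⟩ : ∃ i, j = i + 1 := by
    cases j with
    | zero => rw [sweep_zero] at hj; omega
    | succ i => exact ⟨i, rfl⟩
  have hi := hmin i (by omega)
  push Not at hi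
  have hlt := mul_moved_sweep_succ_lt (M := M) (lab := lab) (σ := σ) hk s s' i
  have hs₁ := Nat.mul_le_mul_left M (load_le_add_moved (sweep M k lab σ s s' (i + 1))
    (sweep M k lab σ s s' i) s)
  have hs₂ := Nat.mul_le_mul_left M (load_le_add_moved (sweep M k lab σ s s' i)
    (sweep M k lab σ s s' (i + 1)) s')
  rw [moved_comm, Nat.mul_add] at hs₁
  rw [Nat.mul_add] at hs₂
  set υ := sweep M k lab σ s s' (i + 1) with hυ
  have hload : ∀ r, r ≠ s → r ≠ s' → load υ r = load σ r := fun r hr hr' =>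
    load_sweep_of_ne hr hr' _
  refine ⟨i + 1, hjn, ?_⟩
  rw [← hυ]
  have hover : (G.filter fun r => (M + 4) * k < M * load υ r) ⊆
      (G.filter fun r => (M + 4) * k < M * load σ r) := by
    intro r hr
    rw [Finset.mem_filter] at *
    refine ⟨hr.1, ?_⟩
    by_cases h₁ : r = s
    · rwa [h₁]
    by_cases h₂ : r = s'
    · rw [h₂] at hr
      omega
    · rw [← hload r h₁ h₂]
      exact hr.2
  have hunder : (G.filter fun r => M * load υ r ≤ (M + 3) * k) ⊆
      (G.filter fun r => M * load σ r ≤ (M + 3) * k) := by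
    intro r hr
    rw [Finset.mem_filter] at *
    refine ⟨hr.1, ?_⟩
    by_cases h₂ : r = s'
    · rwa [h₂]
    by_cases h₁ : r = s
    · rw [h₁] at hr
      omega
    · rw [← hload r h₁ h₂]
      exact hr.2
  unfold imbalance
  rcases hj with hj | hj
  · refine Nat.add_lt_add_of_lt_of_le (Finset.card_lt_card ⟨hover, fun hsub => ?_⟩)
      (Finset.card_le_card hunder)
    have := (Finset.mem_filter.1 (hsub (Finset.mem_filter.2 ⟨hs, h⟩))).2
    omega
  · refine Nat.add_lt_add_of_le_of_lt (Finset.card_le_card hover)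
      (Finset.card_lt_card ⟨hunder, fun hsub => ?_⟩)
    have := (Finset.mem_filter.1 (hsub (Finset.mem_filter.2 ⟨hs', h'⟩))).2
    omega

/-- If the big classes on the servers in `G` leave some space on each of them, and the average
volume is small, then few sweeps suffice to remove all overloads in `G`. -/
theorem exists_sweeps (hk : 1 ≤ k) {G : Finset (Fin ℓ)}
    (hbig : ∀ s ∈ G, M * bigLoad M k lab σ s ≤ (M + 1) * k)
    (hsum : M * ∑ s ∈ G, load σ s ≤ (M + 1) * k * G.card) (m : ℕ) (hm : imbalance M k G σ ≤ m) :
    ∃ i ≤ m, ∃ υ, Reach M k lab i σ υ ∧ (∀ s ∈ G, M * load υ s ≤ (M + 4) * k) ∧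
      ∀ s ∉ G, load υ s = load σ s := by
  induction m generalizing σ with
  | zero =>
    refine ⟨0, le_rfl, σ, rfl, fun s hs => ?_, fun _ _ => rfl⟩
    by_contra! h
    have : 0 < (G.filter fun s => (M + 4) * k < M * load σ s).card :=
      Finset.card_pos.2 ⟨s, Finset.mem_filter.2 ⟨hs, h⟩⟩
    unfold imbalance at hm
    omega
  | succ m ih =>
    by_cases hover : ∃ s ∈ G, (M + 4) * k < M * load σ s
    · obtain ⟨s, hs, h⟩ := hover
      obtain ⟨s', hs', h'⟩ : ∃ s' ∈ G, M * load σ s' ≤ (M + 3) * k := by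
        by_contra! hall
        have h₁ : ∑ s ∈ G, (M + 3) * k ≤ ∑ s ∈ G, M * load σ s :=
          Finset.sum_le_sum fun s hs => (hall s hs).le
        rw [Finset.sum_const, smul_eq_mul, ← Finset.mul_sum] at h₁
        have h₂ : 0 < G.card := Finset.card_pos.2 ⟨s, hs⟩
        have h₃ : (M + 1) * k < (M + 3) * k := Nat.mul_lt_mul_of_pos_right (by omega) (by omega)
        nlinarith
      obtain ⟨j, hj, hlt⟩ := exists_sweep hk hs hs' h h' (hbig s hs)
      obtain ⟨i, hi, υ, h₁, h₂, h₃⟩ := ih (σ := sweep M k lab σ s s' j)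
        (fun r hr => by rw [bigLoad_sweep]; exact hbig r hr)
        (by rw [sum_load_sweep hs hs']; exact hsum) (by omega)
      have hone : Reach M k lab 1 σ (sweep M k lab σ s s' j) :=
        ⟨σ, rfl, n, j, le_rfl, hj, s, s', rfl⟩
      refine ⟨1 + i, by omega, υ, hone.trans h₁, h₂, fun r hr => ?_⟩
      rw [h₃ r hr, load_sweep_of_ne] <;>
      · rintro rfl
        contradiction
    · push Not at hover
      exact ⟨0, by omega, σ, rfl, hover, fun _ _ => rfl⟩

/-! ### Existence of improvements -/

/-- The type of a class: its volume, rounded down to a multiple of `1 / M ^ 2`. -/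
def classType (M k : ℕ) (lab : Fin n → Fin n) (a : Fin n) : Fin (M ^ 2 + 1) :=
  Fin.ofNat _ (M ^ 2 * classSize lab a / k)

/-- The big classes, which have volume at least `1 / M`. -/
def bigClasses (M k : ℕ) (lab : Fin n → Fin n) : Finset (Fin n) :=
  Finset.univ.filter fun a => lab a = a ∧ k ≤ M * classSize lab a

/-- The big classes of type `q` on the server `s`. -/
def bigOn (M k : ℕ) (lab : Fin n → Fin n) (σ : Fin n → Fin ℓ) (s : Fin ℓ)
    (q : Fin (M ^ 2 + 1)) : Finset (Fin n) :=
  (bigClasses M k lab).filter fun a => σ a = s ∧ classType M k lab a = q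

theorem card_mul_le_of_big (hσ : Compatible lab σ) {A : Finset (Fin n)} {s : Fin ℓ}
    (hA : A ⊆ bigClasses M k lab) (hs : ∀ a ∈ A, σ a = s) : A.card * k ≤ M * load σ s := by
  refine le_trans ?_ (Nat.mul_le_mul_left M (sum_classSize_le_load hσ hs))
  rw [Finset.mul_sum, ← smul_eq_mul, ← Finset.sum_const]
  exact Finset.sum_le_sum fun a ha => (Finset.mem_filter.1 (hA ha)).2.2

theorem card_le_of_big {c : ℕ} (hk : 1 ≤ k) (hσ : Compatible lab σ) {A : Finset (Fin n)}
    {s : Fin ℓ} (hA : A ⊆ bigClasses M k lab) (hs : ∀ a ∈ A, σ a = s) (hc : load σ s ≤ c * k) :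
    A.card ≤ M * c := by
  have h₁ := card_mul_le_of_big hσ hA hs
  have h₂ := Nat.mul_le_mul_left M hc
  refine Nat.le_of_mul_le_mul_right (c := k) ?_ hk
  rw [Nat.mul_assoc]
  exact h₁.trans h₂

/-- Classes of the same type have volumes that differ by at most `1 / M ^ 2`. -/
theorem classSize_le_of_classType_eq (hk : 1 ≤ k) (hsize : ∀ a, classSize lab a ≤ k)
    {a b : Fin n} (h : classType M k lab a = classType M k lab b) :
    M ^ 2 * classSize lab a ≤ M ^ 2 * classSize lab b + k := by
  have hlt : ∀ a, M ^ 2 * classSize lab a / k < M ^ 2 + 1 := fun a =>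
    Nat.lt_succ_of_le (Nat.div_le_of_le_mul (by
      rw [Nat.mul_comm k]
      exact Nat.mul_le_mul_left _ (hsize a)))
  have h₁ := congrArg Fin.val h
  simp only [classType, Fin.val_ofNat, Nat.mod_eq_of_lt (hlt a), Nat.mod_eq_of_lt (hlt b)] at h₁
  have h₂ := Nat.div_mul_le_self (M ^ 2 * classSize lab b) k
  have h₃ := Nat.lt_div_mul_add (a := M ^ 2 * classSize lab a) hk
  rw [h₁] at h₃
  omega

/-- There are boundedly many servers, among them `t`, that contain as many big classes of every
type as the same number of servers in the assignment `τ`, and whose average volume is small. The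
relevant data of a server are the numbers of big classes of each type and the rounded volume. -/
theorem exists_exchange (M : ℕ) : ∃ K : ℕ, ∀ (n ℓ k : ℕ) (lab : Fin n → Fin n)
    (σ τ : Fin n → Fin ℓ) (t : Fin ℓ), n = ℓ * k → 1 ≤ k → Compatible lab σ → Compatible lab τ →
      (∀ s, load τ s ≤ k) → (∀ s, load σ s ≤ 3 * k) →
      ∃ G G' : Finset (Fin ℓ), t ∈ G ∧ G.card ≤ K ∧ G.card = G'.card ∧
        (∀ q, ∑ s ∈ G, (bigOn M k lab σ s q).card = ∑ s ∈ G', (bigOn M k lab τ s q).card) ∧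
        M * ∑ s ∈ G, load σ s ≤ (M + 1) * k * G.card := by
  obtain ⟨K, hK⟩ := exists_bounded_subfamilies
    ((Fin (M ^ 2 + 1) → Fin (M * 3 + 1)) × Fin (M * 3 + 2)) (Fin (M ^ 2 + 1) → Fin (M * 3 + 1))
    fun x y => ∑ i, x i * 1 = ∑ i, y i * 1 ∧
      (∀ q, ∑ i, x i * (i.1 q).val = ∑ i, y i * (i q).val) ∧
      ∑ i, x i * i.2.val ≤ ∑ i, x i * (M + 1)
  refine ⟨K, fun n ℓ k lab σ τ t hn hk hσ hτ hτk hσk => ?_⟩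
  have hbig : ∀ {υ : Fin n → Fin ℓ}, Compatible lab υ → (∀ s, load υ s ≤ 3 * k) → ∀ s q,
      (bigOn M k lab υ s q).card % (M * 3 + 1) = (bigOn M k lab υ s q).card := by
    intro υ hυ hc s q
    refine Nat.mod_eq_of_lt (Nat.lt_succ_of_le (card_le_of_big hk hυ (Finset.filter_subset _ _)
      (fun a ha => (Finset.mem_filter.1 ha).2.1) (hc s)))
  have hlev : ∀ s, (M * load σ s / k + 1) % (M * 3 + 2) = M * load σ s / k + 1 := by
    intro s
    refine Nat.mod_eq_of_lt ?_
    have : M * load σ s / k ≤ M * 3 := Nat.div_le_of_le_mul (by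
      have := Nat.mul_le_mul_left M (hσk s)
      linarith)
    omega
  have hτk' : ∀ s, load τ s ≤ 3 * k := fun s => (hτk s).trans (by omega)
  have htotal : ∀ (υ : Fin n → Fin ℓ) (q : Fin (M ^ 2 + 1)), ∑ s, (bigOn M k lab υ s q).card =
      ((bigClasses M k lab).filter fun a => classType M k lab a = q).card := by
    intro υ q
    rw [Finset.card_eq_sum_card_fiberwise (f := υ) (t := Finset.univ) (by simp)]
    refine Finset.sum_congr rfl fun s _ => congrArg Finset.card ?_
    ext a
    simp only [bigOn, Finset.mem_filter]
    tauto
  obtain ⟨G, G', htG, hGK, h₁, h₂, h₃⟩ := hK ℓ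
    (fun s => (fun q => Fin.ofNat _ (bigOn M k lab σ s q).card, Fin.ofNat _ (M * load σ s / k + 1)))
    (fun s q => Fin.ofNat _ (bigOn M k lab τ s q).card) t (by
      refine ⟨?_, fun q => ?_, ?_⟩
      · rw [sum_card_fiber_mul _ _ fun _ => 1, sum_card_fiber_mul _ _ fun _ => 1]
      · rw [sum_card_fiber_mul _ _ fun i : (Fin (M ^ 2 + 1) → Fin (M * 3 + 1)) × Fin (M * 3 + 2) =>
          (i.1 q).val, sum_card_fiber_mul _ _ fun i : Fin (M ^ 2 + 1) → Fin (M * 3 + 1) =>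
          (i q).val]
        simp only [Fin.val_ofNat, hbig hσ hσk, hbig hτ hτk', htotal]
      · rw [sum_card_fiber_mul _ _ fun i : (Fin (M ^ 2 + 1) → Fin (M * 3 + 1)) × Fin (M * 3 + 2) =>
          i.2.val, sum_card_fiber_mul _ _ fun _ => M + 1]
        simp only [Fin.val_ofNat, hlev]
        rw [Finset.sum_add_distrib]
        have h₁ : (∑ s, M * load σ s / k) * k ≤ M * ℓ * k := by
          rw [Finset.sum_mul]
          refine (Finset.sum_le_sum fun s _ => Nat.div_mul_le_self _ _).trans ?_
          rw [← Finset.mul_sum, sum_load, hn, Nat.mul_assoc]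
        have h₂ := Nat.le_of_mul_le_mul_right h₁ hk
        simp only [Finset.sum_const, Finset.card_univ, Fintype.card_fin, smul_eq_mul]
        linarith)
  refine ⟨G, G', htG, hGK, ?_, fun q => ?_, ?_⟩
  · rw [sum_card_fiber_mul _ _ fun _ => 1, sum_card_fiber_mul _ _ fun _ => 1] at h₁
    simpa using h₁
  · have := h₂ q
    rw [sum_card_fiber_mul _ _ fun i : (Fin (M ^ 2 + 1) → Fin (M * 3 + 1)) × Fin (M * 3 + 2) =>
      (i.1 q).val, sum_card_fiber_mul _ _ fun i : Fin (M ^ 2 + 1) → Fin (M * 3 + 1) =>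
      (i q).val] at this
    simpa only [Fin.val_ofNat, hbig hσ hσk, hbig hτ hτk'] using this
  · rw [sum_card_fiber_mul _ _ fun i : (Fin (M ^ 2 + 1) → Fin (M * 3 + 1)) × Fin (M * 3 + 2) =>
      i.2.val, sum_card_fiber_mul _ _ fun _ => M + 1] at h₃
    simp only [Fin.val_ofNat, hlev] at h₃
    rw [Finset.mul_sum]
    have : ∑ s ∈ G, M * load σ s ≤ (∑ s ∈ G, (M * load σ s / k + 1)) * k := by
      rw [Finset.sum_mul]
      refine Finset.sum_le_sum fun s _ => ?_
      have := Nat.lt_div_mul_add (a := M * load σ s) hk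
      linarith
    refine this.trans ((Nat.mul_le_mul_right k h₃).trans (le_of_eq ?_))
    rw [Finset.sum_const, smul_eq_mul]
    ring

/-- The big classes on the servers in `G` may be redistributed among them as in `τ`. -/
theorem exists_redistribution (hM : 1 ≤ M) (hk : 1 ≤ k) (hτ : Compatible lab τ)
    (hτk : ∀ s, load τ s ≤ k) (G G' : Finset (Fin ℓ)) (hcard : G.card = G'.card)
    (hbig : ∀ q, ∑ s ∈ G, (bigOn M k lab σ s q).card = ∑ s ∈ G', (bigOn M k lab τ s q).card) :
    ∃ ρ : Fin n → Fin ℓ, (∀ a ∈ bigClasses M k lab, σ a ∈ G → ρ a ∈ G) ∧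
      ∀ s ∈ G, M * ∑ a ∈ (bigClasses M k lab).filter (fun a => σ a ∈ G ∧ ρ a = s),
        classSize lab a ≤ (M + 1) * k := by
  have hfib : ∀ (υ : Fin n → Fin ℓ) (H : Finset (Fin ℓ)) (q : Fin (M ^ 2 + 1)),
      (((bigClasses M k lab).filter fun a => υ a ∈ H).filter fun a =>
        classType M k lab a = q).card = ∑ s ∈ H, (bigOn M k lab υ s q).card := by
    intro υ H q
    rw [Finset.card_eq_sum_card_fiberwise (f := υ) (t := H)
      (by intro a; simp +contextual)]
    refine Finset.sum_congr rfl fun s hs => congrArg Finset.card ?_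
    ext a
    simp only [bigOn, Finset.mem_filter]
    constructor
    · tauto
    · rintro ⟨h₁, rfl, h₂⟩
      tauto
  obtain ⟨β, hβ, hinj⟩ := exists_injOn_of_card_fiber_eq
    ((bigClasses M k lab).filter fun a => σ a ∈ G) ((bigClasses M k lab).filter fun a => τ a ∈ G')
    (classType M k lab) (fun q => by rw [hfib, hfib, hbig])
  have hsize : ∀ a, classSize lab a ≤ k := fun a => (classSize_le_load hτ a).trans (hτk _)
  let e : G ≃ G' := Finset.equivOfCardEq hcard
  classical
  refine ⟨fun a => if h : τ (β a) ∈ G' then (e.symm ⟨τ (β a), h⟩ : Fin ℓ) else σ a,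
    fun a ha haG => ?_, fun s hs => ?_⟩
  · have h := (Finset.mem_filter.1 (hβ a (Finset.mem_filter.2 ⟨ha, haG⟩)).1).2
    simp only [h, dif_pos]
    exact (e.symm _).2
  set A := (bigClasses M k lab).filter fun a => σ a ∈ G ∧
    (if h : τ (β a) ∈ G' then (e.symm ⟨τ (β a), h⟩ : Fin ℓ) else σ a) = s with hA
  have hmem : ∀ a ∈ A, a ∈ (bigClasses M k lab).filter fun a => σ a ∈ G := by
    intro a ha
    rw [hA, Finset.mem_filter] at ha
    exact Finset.mem_filter.2 ⟨ha.1, ha.2.1⟩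
  have hτs : ∀ a ∈ A, τ (β a) = e ⟨s, hs⟩ := by
    intro a ha
    have h := (Finset.mem_filter.1 (hβ a (hmem a ha)).1).2
    rw [hA, Finset.mem_filter] at ha
    have h' := ha.2.2
    rw [dif_pos h] at h'
    have h'' : e.symm ⟨τ (β a), h⟩ = ⟨s, hs⟩ := Subtype.ext h'
    rw [Equiv.symm_apply_eq] at h''
    rw [← h'']
  have himage : ∀ b ∈ A.image β, τ b = e ⟨s, hs⟩ := by
    intro b hb
    obtain ⟨a, ha, rfl⟩ := Finset.mem_image.1 hb
    exact hτs a ha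
  have hsub : A.image β ⊆ bigClasses M k lab := by
    intro b hb
    obtain ⟨a, ha, rfl⟩ := Finset.mem_image.1 hb
    exact (Finset.mem_filter.1 (hβ a (hmem a ha)).1).1
  have hinjA : Set.InjOn β A := hinj.mono fun a ha => hmem a ha
  have hcardA : A.card ≤ M * 1 := by
    rw [← Finset.card_image_of_injOn hinjA]
    exact card_le_of_big hk hτ hsub himage (by simpa using hτk _)
  -- at most `M` classes fit, and each of them exceeds its counterpart by at most `1 / M ^ 2`
  have h₁ : ∑ a ∈ A, M ^ 2 * classSize lab a ≤ ∑ a ∈ A, (M ^ 2 * classSize lab (β a) + k) :=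
    Finset.sum_le_sum fun a ha =>
      classSize_le_of_classType_eq hk hsize (hβ a (hmem a ha)).2.symm
  have h₂ : ∑ a ∈ A, classSize lab (β a) ≤ k := by
    rw [← Finset.sum_image (f := fun b => classSize lab b) hinjA]
    exact (sum_classSize_le_load hτ himage).trans (hτk _)
  rw [Finset.sum_add_distrib, ← Finset.mul_sum, ← Finset.mul_sum, Finset.sum_const,
    smul_eq_mul] at h₁
  have h₃ := Nat.mul_le_mul_left (M ^ 2) h₂
  have h₄ := Nat.mul_le_mul_right k hcardA
  refine le_of_mul_le_mul_left (a := M) ?_ hM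
  linarith [show M * (M * ∑ a ∈ A, classSize lab a) = M ^ 2 * ∑ a ∈ A, classSize lab a by ring,
    show M * ((M + 1) * k) = M ^ 2 * k + M * 1 * k by ring]

/-- A bounded number of elementary operations yields an improvement, whenever the classes can be
assigned to the servers within their capacity. -/
theorem exists_improvement (M : ℕ) (hM : 1 ≤ M) : ∃ N : ℕ, ∀ (n ℓ k : ℕ) (lab : Fin n → Fin n)
    (σ τ : Fin n → Fin ℓ) (t : Fin ℓ), n = ℓ * k → 1 ≤ k → IsLabelling lab → Compatible lab σ →
      Compatible lab τ → (∀ s, load τ s ≤ k) → (∀ s, load σ s ≤ 3 * k) →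
      ∃ σ', Reach M k lab N σ σ' ∧ Improves M k t σ σ' := by
  obtain ⟨K, hK⟩ := exists_exchange M
  refine ⟨K * (M * 3) + K, fun n ℓ k lab σ τ t hn hk hl hσ hτ hτk hσk => ?_⟩
  obtain ⟨G, G', htG, hGK, hcard, hbig, hsum⟩ := hK n ℓ k lab σ τ t hn hk hσ hτ hτk hσk
  obtain ⟨ρ, hρG, hρ⟩ := exists_redistribution hM hk hτ hτk G G' hcard hbig
  set B := (bigClasses M k lab).filter fun a => σ a ∈ G with hB
  have hBcard : B.card ≤ K * (M * 3) := by
    rw [Finset.card_eq_sum_card_fiberwise (f := σ) (t := G) (by intro a; simp [hB])]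
    refine (Finset.sum_le_sum (g := fun _ => M * 3) fun s _ => card_le_of_big (k := k) hk hσ
      ((Finset.filter_subset _ _).trans (Finset.filter_subset _ _))
      (fun a ha => (Finset.mem_filter.1 ha).2) (hσk s)).trans ?_
    rw [Finset.sum_const, smul_eq_mul]
    exact Nat.mul_le_mul_right _ hGK
  set σ₁ : Fin n → Fin ℓ := fun v => if lab v ∈ B then ρ (lab v) else σ v with hσ₁
  have hreach : Reach M k lab B.card σ σ₁ := reach_move ρ B
  have hmem : ∀ v, lab v ∈ B → σ v ∈ G ∧ σ₁ v ∈ G := by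
    intro v hv
    have hv' := Finset.mem_filter.1 hv
    rw [hσ₁]
    simp only [hv, if_true]
    exact ⟨hσ v ▸ hv'.2, hρG _ hv'.1 hv'.2⟩
  have hnot : ∀ v, lab v ∉ B → σ₁ v = σ v := fun v hv => if_neg hv
  have hload : ∀ s ∉ G, load σ₁ s = load σ s := by
    intro s hs
    unfold load
    congr 1
    ext v
    simp only [Finset.mem_filter, Finset.mem_univ, true_and]
    by_cases hv : lab v ∈ B
    · have := hmem v hv
      constructor
      · rintro rfl
        exact absurd this.2 hs
      · rintro rfl
        exact absurd this.1 hs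
    · rw [hnot v hv]
  have hsum₁ : M * ∑ s ∈ G, load σ₁ s ≤ (M + 1) * k * G.card := by
    refine le_trans (le_of_eq ?_) hsum
    rw [sum_load_eq, sum_load_eq]
    congr 2
    ext v
    simp only [Finset.mem_filter, Finset.mem_univ, true_and]
    by_cases hv : lab v ∈ B
    · have := hmem v hv
      simp [this]
    · rw [hnot v hv]
  have hbig₁ : ∀ s ∈ G, M * bigLoad M k lab σ₁ s ≤ (M + 1) * k := by
    intro s hs
    refine le_trans (Nat.mul_le_mul_left M ?_) (hρ s hs)
    rw [sum_classSize_eq]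
    refine Finset.card_le_card fun v hv => ?_
    simp only [Finset.mem_filter, Finset.mem_univ, true_and, bigClasses] at *
    obtain ⟨hv₁, hv₂⟩ := hv
    have hσG : σ v ∈ G := by
      by_cases hv : lab v ∈ B
      · exact (hmem v hv).1
      · rw [← hnot v hv, hv₁]
        exact hs
    have hvB : lab v ∈ B := by
      rw [hB, Finset.mem_filter]
      exact ⟨by simp [hl v, hv₂], by rwa [hσ v]⟩
    refine ⟨⟨hl v, hv₂⟩, by rwa [hσ v], ?_⟩
    rw [← hv₁, hσ₁]
    simp only [hvB, if_true]
  obtain ⟨i, hi, υ, hυ, h₁, h₂⟩ := exists_sweeps hk hbig₁ hsum₁ _ (imbalance_le G)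
  refine ⟨υ, (hreach.trans hυ).mono t (by omega), fun s => ?_⟩
  by_cases hs : s ∈ G
  · exact .inl (h₁ s hs)
  · refine .inr ⟨?_, (h₂ s hs).trans (hload s hs) |>.le⟩
    rintro rfl
    exact hs htG

end OnlinePacking

/-! ### The invariant of a run -/

namespace OnlinePacking

open GraphPartitioning

section Invariant

variable {n ℓ M k N : ℕ} {R : ℝ}

/-- The state with phase `p`, labels `lab` and assignment `σ` is reached after the requests `es` at
cost `c`, measured in vertex moves. Here `τ` is an assignment for all requests. In the first phase,
the classes are about as close to home as possible. The second phase is only entered if `τ` moves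
many vertices. -/
structure Invariant (M k : ℕ) (R : ℝ) (src τ : Fin n → Fin ℓ) (es : List (Fin n × Fin n))
    (p : Bool) (lab : Fin n → Fin n) (σ : Fin n → Fin ℓ) (c : ℝ) : Prop where
  isLabelling : IsLabelling lab
  compatible : Compatible lab σ
  compatible_opt : Compatible lab τ
  edges : ∀ e ∈ es, lab e.1 = lab e.2
  fits : Fits M k σ
  first : p = true → (∀ a, foreign src lab a (σ a) ≤ 2 * minForeign src lab a) ∧
    c + 4 * moved src σ ≤ 40 * minorityPotential src lab
  second : p = false → 4 * k ≤ M * moved src τ ∧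
    c + R * excess M k σ ≤ 40 * (moved src τ * (1 + Real.log k)) + R * M * n +
      2 * (1 + R * M) * sizePotential lab

variable {src τ σ σ' : Fin n → Fin ℓ} {es : List (Fin n × Fin n)} {p p' : Bool}
  {lab lab' : Fin n → Fin n} {c : ℝ}

theorem Invariant.init (hsrc : ∀ s, load src s = k) :
    Invariant M k R src τ [] true id src 0 where
  isLabelling _ := rfl
  compatible _ := rfl
  compatible_opt _ := rfl
  edges := by simp
  fits s := by
    rw [hsrc]
    exact Nat.mul_le_mul_right _ (by omega)
  first _ := by
    have h : ∀ a, foreign src id a (src a) = 0 := fun a => by simp [foreign]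
    refine ⟨fun a => by rw [h]; exact Nat.zero_le _, ?_⟩
    have h₁ : moved src src = 0 := by simp [moved]
    have h₂ : minorityPotential src id = 0 := by
      refine Finset.sum_eq_zero fun a _ => ?_
      rw [Nat.le_zero.1 ((minForeign_le (src a)).trans (h a).le)]
      simp
    simp [h₁, h₂]
  second h := by simp at h

/-- If the first phase ends, then many vertices have to be moved away from their sources. -/
theorem four_mul_le_of_not_fits (hsrc : ∀ s, load src s = k) (hσ : Compatible lab σ)
    (hτ : Compatible lab τ) (hmin : ∀ a, foreign src lab a (σ a) ≤ 2 * minForeign src lab a)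
    (h : ¬ Fits M k σ) : 4 * k ≤ M * moved src τ := by
  unfold Fits at h
  push Not at h
  obtain ⟨s, hs⟩ := h
  have h₁ := load_le_add_moved src σ s
  rw [hsrc] at h₁
  have h₂ : moved src σ ≤ 2 * moved src τ := by
    rw [moved_eq_sum hσ]
    refine (Finset.sum_le_sum fun a _ => hmin a).trans ?_
    rw [← Finset.mul_sum]
    exact Nat.mul_le_mul_left 2 (sum_minForeign_le hτ)
  have h₃ := Nat.mul_le_mul_left M (h₁.trans (Nat.add_le_add_left h₂ k))
  linarith

/-- The estimate of the second phase also holds in the first one. -/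
theorem Invariant.cost_le (h : Invariant M k R src τ es p lab σ c) (hR : 0 ≤ R)
    (hk : ∀ a, classSize lab a ≤ k) :
    c + R * excess M k σ ≤ 40 * (moved src τ * (1 + Real.log k)) + R * M * n +
      2 * (1 + R * M) * sizePotential lab := by
  cases p with
  | false => exact (h.second rfl).2
  | true =>
    have h₁ := (h.first rfl).2
    have h₂ := minorityPotential_le (src := src) h.compatible_opt hk
    have h₃ : (excess M k σ : ℝ) ≤ M * n := by exact_mod_cast excess_le M k σ
    have h₄ := mul_le_mul_of_nonneg_left h₃ hR
    have h₅ := sizePotential_nonneg lab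
    have h₆ : 0 ≤ 2 * (1 + R * M) * sizePotential lab := by positivity
    have h₇ : (0 : ℝ) ≤ moved src σ := by positivity
    linarith

/-- The invariant is preserved when two classes are merged: in the first phase by the estimates for
the attraction and the return home, in the second one since an improvement exists. -/
theorem Invariant.join {a b : Fin n} (h : Invariant M k R src τ es p lab σ c) (hM : 8 ≤ M)
    (hk : 1 ≤ k) (hsrc : ∀ s, load src s = k) (hτ : ∀ s, load τ s ≤ k)
    (hR : R = 3 ^ N * 3)
    (hN : ∀ (lab : Fin n → Fin n) (σ : Fin n → Fin ℓ) (t : Fin ℓ),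
      IsLabelling lab → Compatible lab σ → Compatible lab τ → (∀ s, load σ s ≤ 3 * k) →
      ∃ σ', Reach M k lab N σ σ' ∧ Improves M k t σ σ')
    (ha : lab a = a) (hb : lab b = b) (hab : a ≠ b) (hAB : classSize lab a ≤ classSize lab b)
    (hτab : τ a = τ b) (hj : Joins M N k src lab a b (σ b) σ p p' σ') :
    Invariant M k R src τ es p' (mergeLab lab a b) σ' (c + moved σ σ') := by
  have hl := h.isLabelling
  have hσ := h.compatible
  have hR₀ : 0 ≤ R := by rw [hR]; positivity
  have hl' : IsLabelling (mergeLab lab a b) := hl.merge hb hab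
  have hτ' : Compatible (mergeLab lab a b) τ := h.compatible_opt.merge hτab
  have hσ₁ : Compatible (mergeLab lab a b) (moveClass lab σ a (σ b)) := hσ.attract hl hb hab
  have hsize : ∀ x, classSize lab x ≤ k := fun x =>
    (classSize_le_load h.compatible_opt x).trans (hτ _)
  have hsize' : ∀ x, classSize (mergeLab lab a b) x ≤ k := fun x =>
    (classSize_le_load hτ' x).trans (hτ _)
  have hedges : ∀ e ∈ es, mergeLab lab a b e.1 = mergeLab lab a b e.2 := by
    intro e he
    unfold mergeLab
    rw [h.edges e he]
  have hb₁ : moveClass lab σ a (σ b) b = σ b := by simp [moveClass, hb, hab.symm]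
  have hlb : mergeLab lab a b b = b := by simp [mergeLab, hb]
  have hcost := h.cost_le hR₀ hsize
  have hA := classSize_le_sizePotential_sub ha hab hAB
  have hexc : (excess M k (moveClass lab σ a (σ b)) : ℝ) ≤
      excess M k σ + M * classSize lab a := by
    exact_mod_cast excess_attract_le M k lab σ a (σ b)
  have hmv : (moved σ (moveClass lab σ a (σ b)) : ℝ) ≤ classSize lab a := by
    exact_mod_cast moved_moveClass_le (lab := lab) (σ := σ) (a := a) (t := σ b)
  -- the growth of the classes pays for the attraction and for the volume it adds
  have hattract : c + classSize lab a + R * excess M k (moveClass lab σ a (σ b)) ≤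
      40 * (moved src τ * (1 + Real.log k)) + R * M * n +
        2 * (1 + R * M) * sizePotential (mergeLab lab a b) := by
    have h₁ := mul_le_mul_of_nonneg_left hexc hR₀
    have h₂ := mul_le_mul_of_nonneg_left hA (show 0 ≤ 1 + R * M by positivity)
    linarith
  have hmany : (p = true → ∃ s, IsHome src (mergeLab lab a b) b (σ b) s ∧
      ¬ Fits M k (moveClass (mergeLab lab a b) (moveClass lab σ a (σ b)) b s)) →
      4 * k ≤ M * moved src τ := by
    intro hp
    cases p with
    | false => exact (h.second rfl).1
    | true =>
      obtain ⟨s, hs, hfit⟩ := hp rfl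
      exact four_mul_le_of_not_fits hsrc (hσ₁.moveClass hl') hτ'
        (foreign_attract_home hab hb hl (h.first rfl).1 hs) hfit
  cases hj with
  | home s hs hfit =>
    obtain ⟨hmin, hc⟩ := h.first rfl
    refine ⟨hl', hσ₁.moveClass hl', hτ', hedges, hfit, fun _ =>
      ⟨foreign_attract_home hab hb hl hmin hs, ?_⟩, fun hp => by simp at hp⟩
    have h₁ := attract_cost_le hσ hmin ha hab hAB
    have h₂ : (moved (moveClass lab σ a (σ b)) (moveClass (mergeLab lab a b)
        (moveClass lab σ a (σ b)) b s) : ℝ) + 4 * moved src (moveClass (mergeLab lab a b)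
        (moveClass lab σ a (σ b)) b s) ≤ 4 * moved src (moveClass lab σ a (σ b)) := by
      exact_mod_cast home_cost_le (src := src) (s := s) hσ₁ hlb hl' (by rw [hb₁]; exact hs)
    have h₃ : (moved σ (moveClass (mergeLab lab a b) (moveClass lab σ a (σ b)) b s) : ℝ) ≤
        moved σ (moveClass lab σ a (σ b)) + moved (moveClass lab σ a (σ b))
          (moveClass (mergeLab lab a b) (moveClass lab σ a (σ b)) b s) := by
      exact_mod_cast moved_triangle _ _ _
    linarith
  | attract _ hp hfit =>
    refine ⟨hl', hσ₁, hτ', hedges, hfit, fun hp => by simp at hp, fun _ => ⟨hmany hp, ?_⟩⟩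
    linarith
  | repack _ _ hp hfit hrep =>
    have hload₁ : ∀ s, s ≠ σ b → M * load (moveClass lab σ a (σ b)) s ≤ (M + 8) * k :=
      fun s hs => (Nat.mul_le_mul_left M (load_moveClass_of_ne hs)).trans (h.fits s)
    have hover : (M + 8) * k ≤ M * load (moveClass lab σ a (σ b)) (σ b) := by
      unfold Fits at hfit
      push Not at hfit
      obtain ⟨s, hs⟩ := hfit
      by_cases hsb : s = σ b
      · rw [hsb] at hs
        exact hs.le
      · exact absurd (hload₁ s hsb) (not_le.2 hs)
    have hload₃ : ∀ s, load (moveClass lab σ a (σ b)) s ≤ 3 * k := by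
      intro s
      have h₁ := load_moveClass_le (lab := lab) (σ := σ) (a := a) (t := σ b) s
      have h₂ : load σ s ≤ 2 * k := by
        refine le_of_mul_le_mul_left (a := M) ((h.fits s).trans ?_) (by omega)
        nlinarith
      have := hsize a
      omega
    obtain ⟨hr, hi⟩ : Reach M k (mergeLab lab a b) N (moveClass lab σ a (σ b)) σ' ∧
        Improves M k (σ b) (moveClass lab σ a (σ b)) σ' := by
      rcases hrep with hrep | ⟨-, hno⟩
      · exact hrep
      · obtain ⟨σ'', h₁, h₂⟩ := hN _ _ (σ b) hl' hσ₁ hτ' hload₃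
        exact absurd h₂ (hno σ'' h₁)
    refine ⟨hl', hσ₁.reach hl' hr, hτ', hedges, fun s => ?_, fun hp => by simp at hp,
      fun _ => ⟨hmany hp, ?_⟩⟩
    · rcases hi s with h₁ | ⟨h₁, h₂⟩
      · exact h₁.trans (Nat.mul_le_mul_right _ (by omega))
      · exact (Nat.mul_le_mul_left M h₂).trans (hload₁ s h₁)
    · have h₁ := (reach_bounds hsize' (by omega) hload₃ hr).1
      have h₁' : (moved (moveClass lab σ a (σ b)) σ' : ℝ) ≤ R * k := by
        rw [hR]
        have : (moved (moveClass lab σ a (σ b)) σ' : ℝ) ≤ 3 ^ N * (3 * k) := by exact_mod_cast h₁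
        linarith
      have h₂ : (moved σ σ' : ℝ) ≤ moved σ (moveClass lab σ a (σ b)) +
          moved (moveClass lab σ a (σ b)) σ' := by exact_mod_cast moved_triangle _ _ _
      have h₃ : (excess M k σ' : ℝ) + 4 * k ≤ excess M k (moveClass lab σ a (σ b)) := by
        exact_mod_cast hi.excess_le hover
      have h₄ := mul_le_mul_of_nonneg_left h₃ hR₀
      have h₅ : 0 ≤ R * k := by positivity
      linarith

theorem Invariant.step {e : Fin n × Fin n} (h : Invariant M k R src τ es p lab σ c) (hM : 8 ≤ M)
    (hk : 1 ≤ k) (hsrc : ∀ s, load src s = k) (hτ : ∀ s, load τ s ≤ k)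
    (hR : R = 3 ^ N * 3)
    (hN : ∀ (lab : Fin n → Fin n) (σ : Fin n → Fin ℓ) (t : Fin ℓ),
      IsLabelling lab → Compatible lab σ → Compatible lab τ → (∀ s, load σ s ≤ 3 * k) →
      ∃ σ', Reach M k lab N σ σ' ∧ Improves M k t σ σ')
    (hτe : τ e.1 = τ e.2) (hs : Steps M N k src e p lab σ p' lab' σ') :
    Invariant M k R src τ (es ++ [e]) p' lab' σ' (c + moved σ σ') := by
  cases hs with
  | skip he =>
    have h₀ : moved σ σ = 0 := by simp [moved]
    rw [h₀, Nat.cast_zero, add_zero]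
    refine { h with edges := fun e' he' => ?_ }
    rcases List.mem_append.1 he' with he' | he'
    · exact h.edges e' he'
    · rwa [List.mem_singleton.1 he']
  | join v w _ _ hvw hne hle hj =>
    have hl := h.isLabelling
    have hτvw : τ v = τ w := by
      rcases hvw with rfl | rfl
      exacts [hτe, hτe.symm]
    have hτ₀ := h.compatible_opt
    rw [← h.compatible w] at hj
    have h' := h.join hM hk hsrc hτ hR hN (hl v) (hl w) hne hle
      (by rw [hτ₀ v, hτ₀ w, hτvw]) hj
    refine { h' with edges := fun e' he' => ?_ }
    rcases List.mem_append.1 he' with he' | he'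
    · exact h'.edges e' he'
    · rw [List.mem_singleton.1 he']
      rcases hvw with rfl | rfl <;> simp [mergeLab]

end Invariant

/-! ### The online algorithm -/

/-- The requests as pairs of numbers. -/
def edgeVals {n : ℕ} (es : List (Fin n × Fin n)) : List (ℕ × ℕ) := es.map fun e => (e.1.val, e.2.val)

theorem runL_snoc {k ℓ : ℕ} (M N : ℕ) {src : Fin (ℓ * k) → Fin ℓ}
    {es : List (Fin (ℓ * k) × Fin (ℓ * k))} {e : Fin (ℓ * k) × Fin (ℓ * k)} {p : Bool}
    {lab : Fin (ℓ * k) → Fin (ℓ * k)} {σ : Fin (ℓ * k) → Fin ℓ}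
    (h : runL M N k ℓ (List.ofFn fun v => (src v).val) (edgeVals es) = (p, record src lab σ)) :
    ∃ p' lab' σ', runL M N k ℓ (List.ofFn fun v => (src v).val) (edgeVals (es ++ [e])) =
      (p', record src lab' σ') ∧ Steps M N k src e p lab σ p' lab' σ' := by
  obtain ⟨p', lab', σ', h₁, h₂⟩ := stepL_record M N k (src := src) (lab := lab) (σ := σ) p e
  refine ⟨p', lab', σ', ?_, h₂⟩
  rw [← h₁, ← h]
  simp [runL, edgeVals]

theorem exists_runL_eq_record {k ℓ : ℕ} (M N : ℕ) (src : Fin (ℓ * k) → Fin ℓ)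
    (es : List (Fin (ℓ * k) × Fin (ℓ * k))) : ∃ σ : Fin (ℓ * k) → Fin ℓ, ∃ p lab,
      runL M N k ℓ (List.ofFn fun v => (src v).val) (edgeVals es) = (p, record src lab σ) := by
  induction es using List.reverseRecOn with
  | nil => exact ⟨src, true, id, by simp [runL, edgeVals, initL_record]⟩
  | append_singleton es e ih =>
    obtain ⟨σ, p, lab, h⟩ := ih
    obtain ⟨p', lab', σ', h', -⟩ := runL_snoc M N (e := e) h
    exact ⟨σ', p', lab', h'⟩

theorem record_injective {n ℓ : ℕ} {src : Fin n → Fin ℓ} {lab lab' : Fin n → Fin n}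
    {σ σ' : Fin n → Fin ℓ} (h : record src lab σ = record src lab' σ') : σ = σ' := by
  funext v
  have := congrFun (List.ofFn_injective h) v
  simp only [Prod.mk.injEq] at this
  exact Fin.ext this.2.2

/-- The online algorithm: its assignments are the ones that the list algorithm computes. -/
noncomputable def algorithm (M N : ℕ) : OnlineAlgorithm where
  place _ _ src es := (exists_runL_eq_record M N src es).choose
  place_nil k ℓ src := by
    obtain ⟨p, lab, h⟩ := (exists_runL_eq_record M N src []).choose_spec
    have h' : runL M N k ℓ (List.ofFn fun v => (src v).val)
        (edgeVals ([] : List (Fin (ℓ * k) × Fin (ℓ * k)))) = (true, record src id src) := by simp [runL, edgeVals, initL_record]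
    exact (record_injective (congrArg Prod.snd (h'.symm.trans h))).symm

theorem place_spec {k ℓ : ℕ} (M N : ℕ) (src : Fin (ℓ * k) → Fin ℓ)
    (es : List (Fin (ℓ * k) × Fin (ℓ * k))) :
    ∃ p lab, runL M N k ℓ (List.ofFn fun v => (src v).val) (edgeVals es) =
      (p, record src lab ((algorithm M N).place k ℓ src es)) :=
  (exists_runL_eq_record M N src es).choose_spec

open PolyTimeData in
theorem algorithm_polyTime (M N : ℕ) : (algorithm M N).PolyTime := by
  obtain ⟨p, P, hp⟩ := PT_runL M N
  -- the polynomial bounds the size of the input in terms of `k + ℓ + es.length`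
  refine ⟨p, P.comp (6 * .X ^ 3 + 2 * .X ^ 2 + 8 * .X + 10), fun k ℓ src es => ?_⟩
  obtain ⟨t, ht, hr⟩ := hp (k, ℓ, (List.ofFn fun v => (src v).val), edgeVals es)
  refine ⟨t, ht.trans ?_, ?_⟩
  · rw [Polynomial.eval_comp]
    refine eval_mono P ?_
    have h₁ : esize (List.ofFn fun v => (src v).val) ≤ ℓ * k * (2 * ℓ + 1 + 1) + 1 := by
      refine (esize_list_le (B := 2 * ℓ + 1) fun a ha => ?_).trans (by simp)
      obtain ⟨v, rfl⟩ := (List.mem_ofFn' _ _).1 ha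
      have := (src v).2
      simp only [esize_nat]
      omega
    have h₂ : esize (edgeVals es) ≤ es.length * (4 * (ℓ * k) + 3 + 1) + 1 := by
      refine (esize_list_le (B := 4 * (ℓ * k) + 3) fun a ha => ?_).trans (by simp [edgeVals])
      obtain ⟨e, -, rfl⟩ := List.mem_map.1 ha
      rw [esize_pair, esize_nat, esize_nat]
      have := e.1.2
      have := e.2.2
      omega
    simp only [esize_pair, esize_nat, Polynomial.eval_add, Polynomial.eval_mul,
      Polynomial.eval_pow, Polynomial.eval_X, Polynomial.eval_ofNat]
    set x := k + ℓ + es.length with hx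
    have hℓ : ℓ ≤ x := by omega
    have hk : k ≤ x := by omega
    have hes : es.length ≤ x := by omega
    have h₃ : ℓ * k * (2 * ℓ + 1 + 1) ≤ x * x * (2 * x + 1 + 1) := by gcongr
    have h₄ : es.length * (4 * (ℓ * k) + 3 + 1) ≤ x * (4 * (x * x) + 3 + 1) := by gcongr
    nlinarith
  · obtain ⟨q, lab, hq⟩ := place_spec M N src es
    simp only [hq] at hr
    convert hr using 1
    · simp only [OnlineAlgorithm.encodeInput, OnlineAlgorithm.encodeAssignment, Enc.enc, edgeVals, List.map_ofFn, List.map_map]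
      rfl
    · simp only [OnlineAlgorithm.encodeAssignment, Enc.enc, record, List.map_ofFn]
      rfl


theorem exists_invariant {M N k ℓ : ℕ} {R : ℝ} {src τ : Fin (ℓ * k) → Fin ℓ}
    {es : List (Fin (ℓ * k) × Fin (ℓ * k))} (hM : 8 ≤ M) (hk : 1 ≤ k)
    (hsrc : ∀ s, load src s = k) (hτ : ∀ s, load τ s ≤ k) (hR : R = 3 ^ N * 3)
    (hN : ∀ (lab : Fin (ℓ * k) → Fin (ℓ * k)) (σ : Fin (ℓ * k) → Fin ℓ) (t : Fin ℓ),
      IsLabelling lab → Compatible lab σ → Compatible lab τ → (∀ s, load σ s ≤ 3 * k) →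
      ∃ σ', Reach M k lab N σ σ' ∧ Improves M k t σ σ')
    (hτe : ∀ e ∈ es, τ e.1 = τ e.2) (i : ℕ) (hi : i ≤ es.length) :
    ∃ p lab, runL M N k ℓ (List.ofFn fun v => (src v).val) (edgeVals (es.take i)) =
        (p, record src lab ((algorithm M N).place k ℓ src (es.take i))) ∧
      Invariant M k R src τ (es.take i) p lab ((algorithm M N).place k ℓ src (es.take i))
        (∑ j ∈ Finset.range i, (moved ((algorithm M N).place k ℓ src (es.take j))
          ((algorithm M N).place k ℓ src (es.take (j + 1))) : ℝ)) := by
  induction i with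
  | zero =>
    rw [List.take_zero, (algorithm M N).place_nil]
    refine ⟨true, id, by simp [runL, edgeVals, initL_record], ?_⟩
    simpa using Invariant.init hsrc
  | succ i ih =>
    obtain ⟨p, lab, h₁, h₂⟩ := ih (by omega)
    have hlt : i < es.length := by omega
    have htake : es.take (i + 1) = es.take i ++ [es[i]] := by
      rw [List.take_append_getElem]
    obtain ⟨p', lab', σ', h₃, h₄⟩ := runL_snoc M N (e := es[i]) h₁
    have h₅ : σ' = (algorithm M N).place k ℓ src (es.take (i + 1)) := by
      obtain ⟨q, lab'', h⟩ := place_spec M N src (es.take (i + 1))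
      rw [htake, h₃] at h
      rw [htake]
      exact record_injective (congrArg Prod.snd h)
    refine ⟨p', lab', by rw [← h₅, htake, h₃], ?_⟩
    rw [Finset.sum_range_succ, ← h₅, htake]
    exact h₂.step hM hk hsrc hτ hR hN (hτe _ (List.getElem_mem hlt)) h₄

/-- Vertices in the same component have the same label. -/
theorem Invariant.cc {n ℓ M k : ℕ} {R c : ℝ} {src τ σ : Fin n → Fin ℓ}
    {es : List (Fin n × Fin n)} {p : Bool} {lab : Fin n → Fin n}
    (h : Invariant M k R src τ es p lab σ c) : CCCondition es σ := by
  have key : ∀ u v, (revealedGraph es).Reachable u v → lab u = lab v := by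
    rintro u v ⟨w⟩
    induction w with
    | nil => rfl
    | cons hadj _ ih =>
      rw [← ih]
      rw [revealedGraph, SimpleGraph.fromRel_adj] at hadj
      rcases hadj.2 with h' | h'
      · exact h.edges _ h'
      · exact (h.edges _ h').symm
  intro u v huv
  rw [← h.compatible u, key u v huv, h.compatible v]

theorem CCCondition.eq_of_mem {n ℓ : ℕ} {τ : Fin n → Fin ℓ} {es : List (Fin n × Fin n)}
    (h : CCCondition es τ) {e : Fin n × Fin n} (he : e ∈ es) : τ e.1 = τ e.2 := by
  by_cases hne : e.1 = e.2
  · rw [hne]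
  · refine h _ _ (SimpleGraph.Adj.reachable ?_)
    rw [revealedGraph, SimpleGraph.fromRel_adj]
    exact ⟨hne, .inl he⟩

/-- The cost in vertex moves is logarithmic in the first phase; in the second phase it is also
compared with the total number of vertices. -/
theorem Invariant.cost_le_mul {M k ℓ : ℕ} {R c : ℝ} {src τ σ : Fin (ℓ * k) → Fin ℓ}
    {es : List (Fin (ℓ * k) × Fin (ℓ * k))} {p : Bool} {lab : Fin (ℓ * k) → Fin (ℓ * k)}
    (h : Invariant M k R src τ es p lab σ c) (hR : 0 ≤ R) (hk : 2 ≤ k)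
    (hτ : ∀ s, load τ s ≤ k) :
    c ≤ (120 + (4 * R * M + 2) * M) * (ℓ * Real.log k) * moved src τ := by
  have hsize : ∀ x, classSize lab x ≤ k := fun x =>
    (classSize_le_load h.compatible_opt x).trans (hτ _)
  have hlog : 1 / 2 ≤ Real.log k := by
    have h₁ := Real.log_le_log (by norm_num) (show (2 : ℝ) ≤ k by exact_mod_cast hk)
    have := Real.log_two_gt_d9
    linarith
  have hm₀ : (0 : ℝ) ≤ moved src τ := by positivity
  have hℓ : (moved src τ : ℝ) ≤ ℓ * moved src τ := by
    rcases Nat.eq_zero_or_pos ℓ with rfl | hpos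
    · have : moved src τ = 0 := by
        have : IsEmpty (Fin (0 * k)) := ⟨fun v => (src v).elim0⟩
        simp [moved]
      simp [this]
    · have : (1 : ℝ) ≤ ℓ := by exact_mod_cast hpos
      nlinarith
  have hmin : 40 * (moved src τ * (1 + Real.log k)) ≤ 120 * (ℓ * Real.log k) * moved src τ := by
    have h₁ : (moved src τ : ℝ) * (1 + Real.log k) ≤ moved src τ * (3 * Real.log k) :=
      mul_le_mul_of_nonneg_left (by linarith) hm₀
    have h₂ := mul_le_mul_of_nonneg_right hℓ (show 0 ≤ 3 * Real.log k by linarith)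
    linarith
  have hpos : 0 ≤ (4 * R * M + 2) * M * (ℓ * Real.log k) * moved src τ := by
    have : 0 ≤ Real.log k := by linarith
    positivity
  cases p with
  | true =>
    have h₁ := (h.first rfl).2
    have h₂ := minorityPotential_le (src := src) h.compatible_opt hsize
    linarith
  | false =>
    obtain ⟨h₁, h₂⟩ := h.second rfl
    have h₃ := sizePotential_le hsize
    have h₄ : (0 : ℝ) ≤ R * excess M k σ := by positivity
    have h₅ : (4 : ℝ) * k ≤ M * moved src τ := by exact_mod_cast h₁
    push_cast at h₂ h₃
    have h₆ := mul_le_mul_of_nonneg_left h₃ (show 0 ≤ 2 * (1 + R * M) by positivity)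
    have hn : (0 : ℝ) ≤ ℓ * k := by positivity
    have h₇ : R * M * (ℓ * k) ≤ R * M * (ℓ * k) * (2 * Real.log k) :=
      le_mul_of_one_le_right (by positivity) (by linarith)
    have h₈ : ((4 * R * M + 2) * (ℓ * Real.log k)) * k ≤
        ((4 * R * M + 2) * (ℓ * Real.log k)) * (M * moved src τ) := by
      refine mul_le_mul_of_nonneg_left ?_ ?_
      · have : (0 : ℝ) ≤ k := by positivity
        linarith
      · have : 0 ≤ Real.log k := by linarith
        positivity
    linarith

theorem moveCost_eq {n ℓ : ℕ} (k : ℕ) (σ τ : Fin n → Fin ℓ) :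
    moveCost k σ τ = moved σ τ * (1 / k) := rfl

/-- The cost of the algorithm is compared with that of an arbitrary offline feasible assignment, and so
in particular with the optimum. -/
theorem exists_competitive_algorithm {ε : ℝ} (hε : 0 < ε) :
    ∃ (C : ℝ) (A : OnlineAlgorithm), A.PolyTime ∧
      ∀ k ℓ : ℕ, 2 ≤ k → ∀ (src : Fin (ℓ * k) → Fin ℓ) (es : List (Fin (ℓ * k) × Fin (ℓ * k))),
        IsInstance src es → A.Serves ε src es ∧
          A.cost src es ≤ C * (ℓ * Real.log k) * optCost k src es := by
  -- the algorithm only knows the lower bound `1 / m` of `ε`, and uses capacity `1 + 8 / (8 * m)`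
  obtain ⟨m, hm⟩ := exists_nat_gt (1 / ε)
  have hm₀ : (0 : ℝ) < m := lt_trans (by positivity) hm
  have hm₁ : 1 ≤ m := by exact_mod_cast hm₀
  have hmε : 1 ≤ ε * m := by
    rw [div_lt_iff₀ hε] at hm
    linarith
  obtain ⟨N, hN⟩ := exists_improvement (8 * m) (by omega)
  refine ⟨120 + (4 * (3 ^ N * 3) * (8 * m : ℕ) + 2) * (8 * m : ℕ), algorithm (8 * m) N,
    algorithm_polyTime _ _, fun k ℓ hk₂ src es ⟨hsrc, hfeas⟩ => ?_⟩
  have hk₀ : (0 : ℝ) < k := by exact_mod_cast (show 0 < k by omega)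
  have : Nonempty {σ : Fin (ℓ * k) → Fin ℓ // OfflineFeasible k es σ} :=
    hfeas.elim fun σ hσ => ⟨⟨σ, hσ⟩⟩
  obtain ⟨⟨τ, hcc, hcap⟩, hopt⟩ := exists_eq_ciInf_of_finite
    (f := fun σ : {σ : Fin (ℓ * k) → Fin ℓ // OfflineFeasible k es σ} => moveCost k src σ.1)
  have hτ : ∀ s, load τ s ≤ k := by
    intro s
    have := hcap s
    rw [mul_one_div, div_le_one hk₀] at this
    exact_mod_cast this
  have hinv := exists_invariant (M := 8 * m) (N := N) (R := 3 ^ N * 3) (by omega)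
    (by omega : 1 ≤ k) hsrc hτ rfl
    (fun lab σ t h₁ h₂ h₃ h₄ => hN _ ℓ k lab σ τ t rfl (by omega) h₁ h₂ h₃ hτ h₄)
    (fun e he => CCCondition.eq_of_mem hcc he)
  constructor
  · intro i hi
    obtain ⟨p, lab, -, h⟩ := hinv i hi
    refine ⟨h.cc, fun s => ?_⟩
    have h₁ : ((8 * m : ℕ) : ℝ) * load ((algorithm (8 * m) N).place k ℓ src (es.take i)) s ≤
        ((8 * m : ℕ) + 8) * k := by exact_mod_cast h.fits s
    push_cast at h₁
    rw [mul_one_div, div_le_iff₀ hk₀]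
    refine le_of_mul_le_mul_left (a := (8 * m : ℝ)) ?_ (by positivity)
    have h₂ := mul_le_mul_of_nonneg_right hmε hk₀.le
    linarith
  · obtain ⟨p, lab, -, h⟩ := hinv es.length le_rfl
    have hcost := h.cost_le_mul (by positivity) hk₂ hτ
    unfold optCost
    rw [← hopt]
    unfold OnlineAlgorithm.cost
    simp only [moveCost_eq]
    rw [← Finset.sum_mul, ← mul_assoc]
    exact mul_le_mul_of_nonneg_right hcost (by positivity)

end OnlinePacking

theorem mainTheorem2 :
    ∃ c : ℝ, 0 < c ∧ ∀ ε : ℝ, 0 < ε →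
      ∃ (C : ℝ) (A : GraphPartitioning.OnlineAlgorithm), A.PolyTime ∧
        ∀ k ℓ : ℕ, c ≤ (k : ℝ) → c ≤ ε ^ 4 * (k : ℝ) →
          ∀ (src : Fin (ℓ * k) → Fin ℓ) (es : List (Fin (ℓ * k) × Fin (ℓ * k))),
            GraphPartitioning.IsInstance src es →
              A.Serves ε src es ∧
                A.cost src es ≤
                  C * ((ℓ : ℝ) * Real.log (k : ℝ)) * GraphPartitioning.optCost k src es := by
  refine ⟨2, by norm_num, fun ε hε => ?_⟩
  obtain ⟨C, A, hA, h⟩ := OnlinePacking.exists_competitive_algorithm hε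
  exact ⟨C, A, hA, fun k ℓ hk _ => h k ℓ (by exact_mod_cast hk)⟩
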